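/- **Setting.** Let $\mathcal Z,\mathcal X$ be measurable spaces, $\mathscr C:\mathcal Z\to\mathcal X$ measurable, $r\in\mathbb N$, and let $\mathcal M$ be a set of pairwise mutually absolutely continuous probability measures on $\mathcal Z$. For a tuple $z_{[r]}=(z_1,\dots,z_r)\in\mathcal Z^r$ write $x_{[r]}=(\mathscr C(z_1),\dots,\mathscr C(z_r))$. For a probability measure $\lambda$ on $\mathcal Z$ let $\lambda_X=\lambda\circ\mathscr C^{-1}$, and let $\lambda^r,\lambda_X^r$ be the $r$-fold product measures. Under $\lambda^r$, $Z_{[r]}=(Z_1,\dots,Z_r)$ is the coordinate tuple and $X_{[r]}=(\mathscr C(Z_j))_{j=1}^r$. Let $u^\star:\mathcal Z^r\to(0,\infty)$ be measurable with $\sup_{P'\in\mathcal M}\|E_{P'^r}[u^\star(Z_{[r]})^2\mid X_{[r]}=\cdot\,]\|_{L^\infty(P_X'^r)}<\infty$. Fix $Q\in\mathcal M$, let $\mathcal T=L^2(Q^r)$, $\mathcal W=L^2(Q_X^r)$, and let $\mathcal U\subset\mathcal T$ be the set of (classes of) measurable $u:\mathcal Z^r\to\mathbb R$ with $|u|\le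 u^\star$ $Q^r$-a.s. Define $\theta:\mathcal M\times\mathcal U\to\mathcal W$ by $$\theta(P,u)(x_{[r]})=E_{P^r}[u(Z_{[r]})\mid X_{[r]}=x_{[r]}].$$ **Tangent spaces.** For $P\in\mathcal M$ and $s\in L^2(P)$, $\mathscr P(P,\mathcal M,s)$ is the set of paths $\{P_\epsilon:\epsilon\in[0,1]\}\subseteq\mathcal M$ with $P_0=P$ and $\int(\sqrt{dP_\epsilon}-\sqrt{dP}-\tfrac{\epsilon}{2}s\sqrt{dP})^2=o(\epsilon^2)$ as $\epsilon\downarrow0$. For $u\in\mathcal U$ and $t\in\mathcal T$, $\mathscr P(u,\mathcal U,t)$ is the set of paths $\{u_\epsilon:\epsilon\in[0,1]\}\subseteq\mathcal U$ with $\|u_\epsilon-u-\epsilon t\|_{\mathcal T}=o(\epsilon)$. The tangent space $\dot{\mathcal M}_P\subseteq L^2(P)$ (resp. $\dot{\mathcal U}_u\subseteq\mathcal T$) is the closed linear span of the set of those $s$ (resp. $t$) for which $\mathscr P(P,\mathcal M,s)$ (resp. $\mathscr P(u,\mathcal U,t)$) is nonempty. The map $\theta$ is totally pathwise differentiable at $(P,u)$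 with differential operator $\dot\theta_{P,u}$ if $\dot\theta_{P,u}:\dot{\mathcal M}_P\oplus\dot{\mathcal U}_u\to\mathcal W$ is a continuous linear operator such that $$\|\theta(P_\epsilon,u_\epsilon)-\theta(P,u)-\epsilon\,\dot\theta_{P,u}(s,t)\|_{\mathcal W}=o(\epsilon)$$ for all $s$, $t$, $\{P_\epsilon\}\in\mathscr P(P,\mathcal M,s)$ and $\{u_\epsilon\}\in\mathscr P(u,\mathcal U,t)$. **Lemma S8 (total pathwise differentiability of the multifold conditional mean).** Fix $(P,u)\in\mathcal M\times\mathcal U$ and suppose that $\mathcal M$ is locally nonparametric at $P$, that is, $\dot{\mathcal M}_P=\{s\in L^2(P):\int s\,dP=0\}$. Suppose also that $\|dQ_X/dP_X\|_{L^\infty(P_X)}<\infty$ and $\|dP/dQ\|_{L^\infty(Q)}<\infty$. Then $\theta$ is well defined as a map into $L^2(Q_X^r)$ and is totally pathwise differentiable at $(P,u)$, with $$\dot\theta_{P,u}(s,t)=\dot\nu_{P,u}(s)+\dot\zeta_{P,u}(t),\qquad \dot\theta_{P,u}^*(w)=(\dot\nu_{P,u}^*(w),\dot\zeta_{P,u}^*(w)),$$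 where $\dot\nu_{P,u}:\dot{\mathcal M}_P\to\mathcal W$ and $\dot\zeta_{P,u}:\dot{\mathcal U}_u\to\mathcal W$ are continuous linear operators, $^*$ denotes the Hermitian adjoint, all conditional means below are of integrable functions, and, almost surely, $$\dot\nu_{P,u}(s)(x_{[r]})=\sum_{i=1}^rE_{P^r}\big[\{u(Z_{[r]})-\theta(P,u)(x_{[r]})\}s(Z_i)\,\big|\,X_{[r]}=x_{[r]}\big],$$ $$\dot\nu_{P,u}^*(w)(z)=\sum_{i=1}^rE_{P^r}\Big[\tfrac{dQ_X^r}{dP_X^r}(X_{[r]})\{u(Z_{[r]})-\theta(P,u)(X_{[r]})\}w(X_{[r]})\,\Big|\,Z_i=z\Big],$$ $$\dot\zeta_{P,u}(t)(x_{[r]})=E_{P^r}[t(Z_{[r]})\mid X_{[r]}=x_{[r]}],$$ $$\dot\zeta_{P,u}^*(w)(z_{[r]})=\tfrac{dP^r}{dQ^r}(z_{[r]})\,\tfrac{dQ_X^r}{dP_X^r}(x_{[r]})\,w(x_{[r]}).$$ (The case $r=1$ is the conditional mean primitive.) -/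

import Mathlib

open MeasureTheory Filter Topology Asymptotics
open scoped ENNReal

/-- A version of the conditional mean `x ↦ E_μ[f | X = x]`, as a function of the value `x` of `X`:
composed with `X` it is the conditional expectation of `f` given the sigma-algebra generated by `X`
(see `condMean_spec`). For a standard Borel sample space this agrees almost everywhere with the
integral of `f` against a regular conditional distribution given `X = x`. -/
noncomputable def condMean {Ω S : Type*} [MeasurableSpace Ω] [mS : MeasurableSpace S]
    (μ : Measure Ω) (X : Ω → S) (f : Ω → ℝ) : S → ℝ :=
  (StronglyMeasurable.exists_eq_measurable_comp
    (stronglyMeasurable_condExp (μ := μ) (m := mS.comap X) (f := f))).choose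

theorem condMean_spec {Ω S : Type*} [MeasurableSpace Ω] [mS : MeasurableSpace S]
    (μ : Measure Ω) (X : Ω → S) (f : Ω → ℝ) :
    StronglyMeasurable (condMean μ X f) ∧ μ[f | mS.comap X] = condMean μ X f ∘ X :=
  (StronglyMeasurable.exists_eq_measurable_comp
    (stronglyMeasurable_condExp (μ := μ) (m := mS.comap X) (f := f))).choose_spec

/-- The law `μ^r` of `r` independent draws from `μ`. -/
noncomputable abbrev iidLaw {S : Type*} [MeasurableSpace S] (r : ℕ) (μ : Measure S) :
    Measure (Fin r → S) :=
  Measure.pi fun _ => μ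

/-- `path` restricted to `[0,1]` is a univariate submodel of `M` through `P`, quadratic mean
differentiable at `0` with score `s`, that is,
`∫ (√dP_ε - √dP - (ε/2) s √dP)² = o(ε²)` as `ε ↓ 0`.
The densities are taken with respect to the dominating measure `P + P_ε`; the integral does not
depend on the choice of the dominating measure. -/
def IsQMDPath {S : Type*} [MeasurableSpace S] (M : Set (ProbabilityMeasure S))
    (P : ProbabilityMeasure S) (s : Lp ℝ 2 (P : Measure S)) (path : ℝ → ProbabilityMeasure S) :
    Prop :=
  (∀ ε ∈ Set.Icc (0 : ℝ) 1, path ε ∈ M) ∧ path 0 = P ∧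
    (fun ε : ℝ =>
      ∫ z, (√(((path ε : Measure S).rnDeriv ((P : Measure S) + (path ε : Measure S)) z).toReal)
          - √(((P : Measure S).rnDeriv ((P : Measure S) + (path ε : Measure S)) z).toReal)
          - ε / 2 * s z *
            √(((P : Measure S).rnDeriv ((P : Measure S) + (path ε : Measure S)) z).toReal)) ^ 2
        ∂((P : Measure S) + (path ε : Measure S)))
      =o[𝓝[>] 0] fun ε : ℝ => ε ^ 2

/-- The tangent set of the model `M` at `P`: all scores of quadratic mean differentiable
submodels. -/
def modelTangentSet {S : Type*} [MeasurableSpace S] (M : Set (ProbabilityMeasure S))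
    (P : ProbabilityMeasure S) : Set (Lp ℝ 2 (P : Measure S)) :=
  {s | ∃ path, IsQMDPath M P s path}

/-- The tangent space of the model `M` at `P`: the `L²(P)`-closure of the linear span of the
tangent set. -/
noncomputable abbrev modelTangentSpace {S : Type*} [MeasurableSpace S]
    (M : Set (ProbabilityMeasure S)) (P : ProbabilityMeasure S) :
    Submodule ℝ (Lp ℝ 2 (P : Measure S)) :=
  (Submodule.span ℝ (modelTangentSet M P)).topologicalClosure

/-- The model `M` is locally nonparametric at `P`: its tangent space consists of all
`P`-mean-zero elements of `L²(P)`. -/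
def IsLocallyNonparametricAt {S : Type*} [MeasurableSpace S] (M : Set (ProbabilityMeasure S))
    (P : ProbabilityMeasure S) : Prop :=
  (modelTangentSpace M P : Set (Lp ℝ 2 (P : Measure S))) = {s | ∫ z, s z ∂(P : Measure S) = 0}

/-- `path` restricted to `[0,1]` stays in the subset `U` of a Hilbert space and satisfies
`‖path ε - u - ε t‖ = o(ε)` as `ε ↓ 0`. -/
def IsHilbertPath {T : Type*} [NormedAddCommGroup T] [InnerProductSpace ℝ T] (U : Set T)
    (u t : T) (path : ℝ → T) : Prop :=
  (∀ ε ∈ Set.Icc (0 : ℝ) 1, path ε ∈ U) ∧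
    (fun ε : ℝ => path ε - u - ε • t) =o[𝓝[>] 0] fun ε : ℝ => ε

/-- The tangent set of `U` at `u`. -/
def hilbertTangentSet {T : Type*} [NormedAddCommGroup T] [InnerProductSpace ℝ T] (U : Set T)
    (u : T) : Set T :=
  {t | ∃ path, IsHilbertPath U u t path}

/-- The tangent space of `U` at `u`: the closure of the linear span of the tangent set. -/
noncomputable abbrev hilbertTangentSpace {T : Type*} [NormedAddCommGroup T]
    [InnerProductSpace ℝ T] (U : Set T) (u : T) : Submodule ℝ T :=
  (Submodule.span ℝ (hilbertTangentSet U u)).topologicalClosure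

/-- The Hilbert direct sum of the tangent space of `M` at `P` and the tangent space of `U` at
`u`. -/
abbrev TotalTangentSpace {S T : Type*} [MeasurableSpace S] [NormedAddCommGroup T]
    [InnerProductSpace ℝ T] (M : Set (ProbabilityMeasure S)) (U : Set T)
    (P : ProbabilityMeasure S) (u : T) : Type _ :=
  WithLp 2 (modelTangentSpace M P × hilbertTangentSpace U u)

/-- The continuous linear operator `D` is the differential operator at `(P, u)` of
`θ : M × U → W`: along all smooth paths `P_ε` in `M` with score `s` and `u_ε` in `U` with
direction `t`, `‖θ(P_ε, u_ε) - θ(P, u) - ε D(s, t)‖ = o(ε)`.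
Only the values of `θ` on `M × U` matter. A score or direction that has a path is in the tangent
set, so the quantifiers over `s` and `t` range over the two tangent sets. -/
def HasTotalPathwiseDerivAt {S T W : Type*} [MeasurableSpace S]
    [NormedAddCommGroup T] [InnerProductSpace ℝ T] [NormedAddCommGroup W] [InnerProductSpace ℝ W]
    (M : Set (ProbabilityMeasure S)) (U : Set T) (θ : ProbabilityMeasure S → T → W)
    (P : ProbabilityMeasure S) (u : T) (D : TotalTangentSpace M U P u →L[ℝ] W) : Prop :=
  ∀ (s : modelTangentSpace M P) (t : hilbertTangentSpace U u)
    (Ppath : ℝ → ProbabilityMeasure S) (upath : ℝ → T),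
    IsQMDPath M P (s : Lp ℝ 2 (P : Measure S)) Ppath → IsHilbertPath U u (t : T) upath →
      (fun ε : ℝ => θ (Ppath ε) (upath ε) - θ P u - ε • D (WithLp.toLp 2 (s, t)))
        =o[𝓝[>] 0] fun ε : ℝ => ε

/-- The coarsening `C` applied to each coordinate, `z_[r] ↦ x_[r]`. -/
def coarsen {Z X : Type*} (C : Z → X) (r : ℕ) (z : Fin r → Z) : Fin r → X :=
  fun j => C (z j)

/-- The `r`-fold conditional mean `x_[r] ↦ E_{P^r}[u(Z_[r]) | X_[r] = x_[r]]`, as a function. -/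
noncomputable def multifoldMean {Z X : Type*} [MeasurableSpace Z] [MeasurableSpace X]
    (C : Z → X) (r : ℕ) (P : ProbabilityMeasure Z) (u : (Fin r → Z) → ℝ) : (Fin r → X) → ℝ :=
  condMean (iidLaw r (P : Measure Z)) (coarsen C r) u

open Classical in
/-- The `r`-fold conditional mean as an element of `L²(Q_X^r)`. The value `0` is used only where
the conditional mean is not square integrable, which does not happen on the domain of interest. -/
noncomputable def multifoldMeanL2 {Z X : Type*} [MeasurableSpace Z] [MeasurableSpace X]
    (C : Z → X) (r : ℕ) (Q P : ProbabilityMeasure Z) (u : Lp ℝ 2 (iidLaw r (Q : Measure Z))) :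
    Lp ℝ 2 (iidLaw r ((Q : Measure Z).map C)) :=
  if h : MemLp (multifoldMean C r P u) 2 (iidLaw r ((Q : Measure Z).map C)) then h.toLp else 0

/-- The set of classes of functions `u` with `|u| ≤ ustar`, `Q^r`-almost surely. -/
def dominatedClass {Z : Type*} [MeasurableSpace Z] (r : ℕ) (Q : ProbabilityMeasure Z)
    (ustar : (Fin r → Z) → ℝ) : Set (Lp ℝ 2 (iidLaw r (Q : Measure Z))) :=
  {u | ∀ᵐ z ∂(iidLaw r (Q : Measure Z)), |u z| ≤ ustar z}

/-! Split θ(P_ε, u_ε) − θ(P, u) as [θ(P_ε, u_ε) − θ(P, u_ε)] + [θ(P, u_ε) − θ(P, u)]. On the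
dominated class, θ(P, ·) is the restriction of a bounded linear operator, because the two density
ratios are essentially bounded. The second bracket is therefore handled by linearity, and the work
lies in the first.

Write μ = P^r, ν = P_ε^r, L = dν/dμ, Λ = E_μ[L | X], and τ for the sum of the two conditional means
of v. Since E_μ[Lv | X] = Λ E_ν[v | X], conditioning (L − 1)(2v − τ) gives (1 + Λ)(E_ν[v | X] −
E_μ[v | X]). Factoring L − 1 = (√L − 1)(√L + 1) yields `condExp_sub_condExp_eq`, the change of the
conditional mean as E_μ[(√L − 1) f | X]. The symmetric normalisation by 1 + Λ is what bounds E_μ[f²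
| X] by a constant, uniformly in ν and without any bound on L (`condExp_sq_ratioFactor_le`).
Quadratic mean differentiability controls (√L − 1)/ε in L². Along subsequences f converges almost
everywhere to 2(u − E_μ[u | X]), and the conditional Cauchy–Schwarz inequality passes the limit
through the product (`tendsto_condExp_differenceQuotient`).

The score of P_ε^r is Σᵢ s(zᵢ): the root density of a product law is a tensor power of the root
density, and `tensorL2` is continuous multilinear, hence differentiable.

The adjoints follow from one duality formula, `inner_condMean_mul`. No projection onto the tangent
spaces is needed: the residual u − E[u | X] has conditional mean zero, so the candidate adjoint in
the measure is already mean zero, and the tangent space of the dominated class is all of L²(Q^r)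
(`hilbertTangentSpace_dominatedClass_eq_top`). -/

/-! ### Conditional Cauchy–Schwarz, conditional bounds and Bayes' rule. -/

section CondSecondMoment

variable {Ω : Type*} {m m0 : MeasurableSpace Ω} {μ : Measure Ω}

/-- Conditional Cauchy–Schwarz inequality, when the conditional second moment of one factor is
bounded. -/
theorem sq_condExp_mul_le [IsFiniteMeasure μ] {b f : Ω → ℝ} (hb : MemLp b 2 μ)
    (hf : MemLp f 2 μ) {c : ℝ} (hc : 0 < c) (hfc : ∀ᵐ ω ∂μ, (μ[fun ω => f ω ^ 2 | m]) ω ≤ c) :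
    ∀ᵐ ω ∂μ, (μ[fun ω => b ω * f ω | m]) ω ^ 2 ≤ c * (μ[fun ω => b ω ^ 2 | m]) ω := by
  have hbf : Integrable (fun ω => b ω * f ω) μ := hb.integrable_mul hf
  have hb2 := hb.integrable_sq
  have hf2 := hf.integrable_sq
  -- Conditioning 0 ≤ (q f − b)². Only rational q are used, so that the exceptional sets have a null
  -- union; density recovers real q.
  have key : ∀ q : ℚ, ∀ᵐ ω ∂μ, 2 * (q : ℝ) * (μ[fun ω => b ω * f ω | m]) ω
      ≤ q ^ 2 * (μ[fun ω => f ω ^ 2 | m]) ω + (μ[fun ω => b ω ^ 2 | m]) ω := by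
    intro q
    have h1 : μ[(2 * (q : ℝ)) • fun ω => b ω * f ω | m]
        ≤ᵐ[μ] μ[((q : ℝ) ^ 2) • (fun ω => f ω ^ 2) + fun ω => b ω ^ 2 | m] := by
      refine condExp_mono (hbf.smul _) ((hf2.smul _).add hb2) (Eventually.of_forall fun ω => ?_)
      simp only [Pi.smul_apply, Pi.add_apply, smul_eq_mul]
      nlinarith [sq_nonneg ((q : ℝ) * f ω - b ω)]
    filter_upwards [h1, condExp_smul (μ := μ) (2 * (q : ℝ)) (fun ω => b ω * f ω) m,
      condExp_smul (μ := μ) ((q : ℝ) ^ 2) (fun ω => f ω ^ 2) m,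
      condExp_add (hf2.smul ((q : ℝ) ^ 2)) hb2 m] with ω h1 h2 h3 h4
    simp only [Pi.smul_apply, Pi.add_apply, smul_eq_mul] at h2 h3 h4
    rw [h2, h4, h3] at h1
    exact h1
  filter_upwards [ae_all_iff.2 key, hfc] with ω hk hω
  set E := (μ[fun ω => b ω * f ω | m]) ω
  set B := (μ[fun ω => b ω ^ 2 | m]) ω
  have hreal : ∀ q : ℝ, 2 * q * E ≤ q ^ 2 * c + B := by
    intro q
    have hcl : IsClosed {q : ℝ | 2 * q * E ≤ q ^ 2 * c + B} :=
      isClosed_le (by fun_prop) (by fun_prop)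
    have hsub : Set.range ((↑) : ℚ → ℝ) ⊆ {q : ℝ | 2 * q * E ≤ q ^ 2 * c + B} := by
      rintro _ ⟨q, rfl⟩
      have := hk q
      have := mul_le_mul_of_nonneg_left hω (sq_nonneg (q : ℝ))
      change 2 * (q : ℝ) * E ≤ q ^ 2 * c + B
      linarith
    exact closure_minimal hsub hcl (Rat.denseRange_cast q)
  -- The value E / c maximises 2qE − q²c.
  have h := hreal (E / c)
  have e1 : 2 * (E / c) * E = 2 * (E ^ 2 / c) := by ring
  have e2 : (E / c) ^ 2 * c = E ^ 2 / c := by field_simp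
  rw [e1, e2] at h
  have : E ^ 2 / c ≤ B := by linarith
  rw [div_le_iff₀ hc] at this
  linarith

theorem eLpNorm_two_eq_lintegral_sq {f : Ω → ℝ} :
    eLpNorm f 2 μ = (∫⁻ ω, ENNReal.ofReal (f ω ^ 2) ∂μ) ^ (1 / 2 : ℝ) := by
  rw [eLpNorm_eq_lintegral_rpow_enorm_toReal two_ne_zero ENNReal.ofNat_ne_top]
  congr 2
  ext ω
  rw [← sq_abs, ENNReal.ofReal_pow (abs_nonneg _), ← Real.enorm_eq_ofReal_abs]
  simp

/-- Integrate the conditional Cauchy–Schwarz inequality. This is the basic estimate of the proof: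
multiplying by `f` and then conditioning is bounded on L² although `f` itself may be unbounded. -/
theorem eLpNorm_condExp_mul_le (hm : m ≤ m0) [IsFiniteMeasure μ] {b f : Ω → ℝ} (hb : MemLp b 2 μ)
    (hf : MemLp f 2 μ) {c : ℝ} (hc : 0 < c) (hfc : ∀ᵐ ω ∂μ, (μ[fun ω => f ω ^ 2 | m]) ω ≤ c) :
    eLpNorm (μ[fun ω => b ω * f ω | m]) 2 μ ≤ ENNReal.ofReal (√c) * eLpNorm b 2 μ := by
  rw [eLpNorm_two_eq_lintegral_sq, eLpNorm_two_eq_lintegral_sq, Real.sqrt_eq_rpow,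
    ← ENNReal.ofReal_rpow_of_nonneg hc.le (by norm_num), ← ENNReal.mul_rpow_of_nonneg _ _
    (by norm_num)]
  refine ENNReal.rpow_le_rpow ?_ (by norm_num)
  have h0 : 0 ≤ᵐ[μ] μ[fun ω => b ω ^ 2 | m] :=
    condExp_nonneg (Eventually.of_forall fun ω => sq_nonneg _)
  calc ∫⁻ ω, ENNReal.ofReal ((μ[fun ω => b ω * f ω | m]) ω ^ 2) ∂μ
      ≤ ∫⁻ ω, ENNReal.ofReal c * ENNReal.ofReal ((μ[fun ω => b ω ^ 2 | m]) ω) ∂μ := by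
        refine lintegral_mono_ae ?_
        filter_upwards [sq_condExp_mul_le hb hf hc hfc] with ω hω
        rw [← ENNReal.ofReal_mul hc.le]
        exact ENNReal.ofReal_le_ofReal hω
    _ = ENNReal.ofReal c * ∫⁻ ω, ENNReal.ofReal (b ω ^ 2) ∂μ := by
        rw [lintegral_const_mul' _ _ ENNReal.ofReal_ne_top,
          ← ofReal_integral_eq_lintegral_ofReal integrable_condExp h0, integral_condExp hm,
          ofReal_integral_eq_lintegral_ofReal hb.integrable_sq
            (Eventually.of_forall fun ω => sq_nonneg _)]

theorem memLp_condExp_mul (hm : m ≤ m0) [IsFiniteMeasure μ] {b f : Ω → ℝ} (hb : MemLp b 2 μ)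
    (hf : MemLp f 2 μ) {c : ℝ} (hc : 0 < c) (hfc : ∀ᵐ ω ∂μ, (μ[fun ω => f ω ^ 2 | m]) ω ≤ c) :
    MemLp (μ[fun ω => b ω * f ω | m]) 2 μ :=
  ⟨(stronglyMeasurable_condExp.mono hm).aestronglyMeasurable,
    (eLpNorm_condExp_mul_le hm hb hf hc hfc).trans_lt
      (ENNReal.mul_lt_top ENNReal.ofReal_lt_top hb.2)⟩

/-- A function whose absolute value is dominated by a function with bounded conditional second
moment has a bounded conditional mean. -/
theorem abs_condExp_le_of_condExp_sq_le (hm : m ≤ m0) [IsFiniteMeasure μ] {v w : Ω → ℝ}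
    (hw : Integrable (fun ω => w ω ^ 2) μ) (hvw : ∀ᵐ ω ∂μ, |v ω| ≤ w ω) {K : ℝ} (hK : 0 < K)
    (hwK : ∀ᵐ ω ∂μ, (μ[fun ω => w ω ^ 2 | m]) ω ≤ K ^ 2) :
    ∀ᵐ ω ∂μ, |(μ[v | m]) ω| ≤ K := by
  by_cases hv : Integrable v μ
  swap
  · simp [condExp_of_not_integrable hv, hK.le]
  -- The inequality w ≤ w²/(2K) + K/2 is chosen so that each term contributes K/2 after
  -- conditioning.
  have hg : Integrable ((1 / (2 * K)) • (fun ω => w ω ^ 2) + fun _ => K / 2) μ :=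
    (hw.smul _).add (integrable_const _)
  have h1 : μ[|v| | m] ≤ᵐ[μ] μ[(1 / (2 * K)) • (fun ω => w ω ^ 2) + fun _ => K / 2 | m] := by
    refine condExp_mono hv.abs hg ?_
    filter_upwards [hvw] with ω hω
    simp only [Pi.abs_apply, Pi.add_apply, Pi.smul_apply, smul_eq_mul]
    refine hω.trans ?_
    rw [← sub_nonneg]
    have : 1 / (2 * K) * w ω ^ 2 + K / 2 - w ω = (w ω - K) ^ 2 / (2 * K) := by
      field_simp; ring
    rw [this]; positivity
  filter_upwards [h1, abs_condExp_ae_le_condExp_abs (μ := μ) (m := m) v, hwK,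
    condExp_smul (μ := μ) (1 / (2 * K)) (fun ω => w ω ^ 2) m,
    condExp_add (hw.smul (1 / (2 * K))) (integrable_const (K / 2)) m] with ω h1 h2 h3 h4 h5
  rw [h5, Pi.add_apply, h4, condExp_const hm] at h1
  simp only [Pi.smul_apply, smul_eq_mul] at h1
  have h6 : 1 / (2 * K) * (μ[fun ω => w ω ^ 2 | m]) ω ≤ 1 / (2 * K) * K ^ 2 := by gcongr
  have h7 : 1 / (2 * K) * K ^ 2 = K / 2 := by field_simp
  have h8 : |(μ[v | m]) ω| ≤ (μ[|v| | m]) ω := h2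
  linarith

/-- Bayes' rule for conditional expectations. -/
theorem condExp_rnDeriv_mul (hm : m ≤ m0) {ν : Measure Ω} [IsFiniteMeasure μ] [IsFiniteMeasure ν]
    (hνμ : ν ≪ μ) {g : Ω → ℝ} (hg : Integrable g ν) :
    μ[fun ω => (ν.rnDeriv μ ω).toReal * g ω | m]
      =ᵐ[μ] fun ω => (μ[fun ω => (ν.rnDeriv μ ω).toReal | m]) ω * (ν[g | m]) ω := by
  have hL : Integrable (fun ω => (ν.rnDeriv μ ω).toReal) μ := Measure.integrable_toReal_rnDeriv
  have hLg : Integrable (fun ω => (ν.rnDeriv μ ω).toReal * g ω) μ :=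
    (integrable_rnDeriv_smul_iff hνμ).2 hg
  have hLc : Integrable (fun ω => (ν.rnDeriv μ ω).toReal * (ν[g | m]) ω) μ :=
    (integrable_rnDeriv_smul_iff hνμ).2 integrable_condExp
  have hpull := condExp_mul_of_stronglyMeasurable_right (m := m) (μ := μ)
    (stronglyMeasurable_condExp (μ := ν) (m := m) (f := g)) hLc hL
  refine (ae_eq_condExp_of_forall_setIntegral_eq hm hLg (fun s _ _ => ?_) (fun s hs _ => ?_)
    ?_).symm
  · exact (integrable_condExp.congr hpull).integrableOn
  · calc ∫ ω in s, (μ[fun ω => (ν.rnDeriv μ ω).toReal | m]) ω * (ν[g | m]) ω ∂μ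
        = ∫ ω in s, (μ[fun ω => (ν.rnDeriv μ ω).toReal * (ν[g | m]) ω | m]) ω ∂μ :=
          integral_congr_ae (ae_restrict_of_ae hpull.symm)
      _ = ∫ ω in s, (ν.rnDeriv μ ω).toReal * (ν[g | m]) ω ∂μ := setIntegral_condExp hm hLc hs
      _ = ∫ ω in s, (ν[g | m]) ω ∂ν := setIntegral_rnDeriv_smul hνμ (hm s hs)
      _ = ∫ ω in s, g ω ∂ν := setIntegral_condExp hm hg hs
      _ = ∫ ω in s, (ν.rnDeriv μ ω).toReal * g ω ∂μ :=
          (setIntegral_rnDeriv_smul hνμ (hm s hs)).symm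
  · exact (stronglyMeasurable_condExp.mul stronglyMeasurable_condExp).aestronglyMeasurable

end CondSecondMoment

/-! ### Change of a conditional mean under a change of measure. -/

section LikelihoodRatio

variable {Ω : Type*} {m m0 : MeasurableSpace Ω} {μ ν : Measure Ω}

/-- The factor `f` for which `ν[v | m] - μ[v | m] = μ[(√(dν/dμ) - 1) f | m]`. -/
noncomputable def ratioFactor (m : MeasurableSpace Ω) {m0 : MeasurableSpace Ω} (μ ν : Measure Ω)
    (v : Ω → ℝ) (ω : Ω) : ℝ :=
  (1 + (μ[fun ω => (ν.rnDeriv μ ω).toReal | m]) ω)⁻¹ *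
    ((√(ν.rnDeriv μ ω).toReal + 1) * (2 * v ω - ((μ[v | m]) ω + (ν[v | m]) ω)))

theorem condExp_rnDeriv_nonneg :
    ∀ᵐ ω ∂μ, 0 ≤ (μ[fun ω => (ν.rnDeriv μ ω).toReal | m]) ω :=
  condExp_nonneg (Eventually.of_forall fun _ => ENNReal.toReal_nonneg)

theorem aestronglyMeasurable_ratioFactor (hm : m ≤ m0) {v : Ω → ℝ}
    (hv : AEStronglyMeasurable v μ) : AEStronglyMeasurable (ratioFactor m μ ν v) μ := by
  have h1 : AEStronglyMeasurable (fun ω => (1 + (μ[fun ω => (ν.rnDeriv μ ω).toReal | m]) ω)⁻¹) μ :=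
    ((measurable_const.add (stronglyMeasurable_condExp.mono hm).measurable).inv).aestronglyMeasurable
  have h2 : AEStronglyMeasurable (fun ω => √(ν.rnDeriv μ ω).toReal + 1) μ := by
    have : Measurable fun ω => √(ν.rnDeriv μ ω).toReal + 1 := by fun_prop
    exact this.aestronglyMeasurable
  exact h1.mul (h2.mul ((hv.const_mul 2).sub
    ((stronglyMeasurable_condExp.mono hm).add
      (stronglyMeasurable_condExp.mono hm)).aestronglyMeasurable))

variable [IsFiniteMeasure μ] [IsFiniteMeasure ν] {v w : Ω → ℝ} {K : ℝ}

/-- With L the density, (√L + 1)² ≤ 2(L + 1), and since both conditional means are at most K in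
absolute value, the other factor squared is at most 8(w² + K²). The product supplies the 16. -/
theorem sq_ratioFactor_le (hm : m ≤ m0) (hνμ : ν ≪ μ) (hμν : μ ≪ ν)
    (hwμ : Integrable (fun ω => w ω ^ 2) μ) (hwν : Integrable (fun ω => w ω ^ 2) ν)
    (hvw : ∀ᵐ ω ∂μ, |v ω| ≤ w ω) (hK : 0 < K)
    (hwKμ : ∀ᵐ ω ∂μ, (μ[fun ω => w ω ^ 2 | m]) ω ≤ K ^ 2)
    (hwKν : ∀ᵐ ω ∂ν, (ν[fun ω => w ω ^ 2 | m]) ω ≤ K ^ 2) :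
    ∀ᵐ ω ∂μ, ratioFactor m μ ν v ω ^ 2 ≤
      16 * (((1 + (μ[fun ω => (ν.rnDeriv μ ω).toReal | m]) ω)⁻¹) ^ 2 *
        (((ν.rnDeriv μ ω).toReal + 1) * (w ω ^ 2 + K ^ 2))) := by
  filter_upwards [hvw, abs_condExp_le_of_condExp_sq_le hm hwμ hvw hK hwKμ,
    hμν (abs_condExp_le_of_condExp_sq_le hm hwν (hνμ hvw) hK hwKν)] with ω h1 h2 h3
  rw [ratioFactor, mul_pow, mul_left_comm]
  refine mul_le_mul_of_nonneg_left ?_ (sq_nonneg _)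
  set L := (ν.rnDeriv μ ω).toReal
  have hL : 0 ≤ L := ENNReal.toReal_nonneg
  have h4 : (√L + 1) ^ 2 ≤ 2 * (L + 1) := by nlinarith [Real.sq_sqrt hL, sq_nonneg (√L - 1)]
  have hv2 : v ω ^ 2 ≤ w ω ^ 2 := by rw [← sq_abs]; gcongr
  set t := (μ[v | m]) ω + (ν[v | m]) ω
  have ht : t ^ 2 ≤ (2 * K) ^ 2 := by
    rw [← sq_abs]
    have : |t| ≤ 2 * K := (abs_add_le _ _).trans (by linarith)
    gcongr
  have h5 : (2 * v ω - t) ^ 2 ≤ 8 * (w ω ^ 2 + K ^ 2) := by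
    nlinarith [sq_nonneg (2 * v ω + t)]
  calc ((√L + 1) * (2 * v ω - t)) ^ 2 = (√L + 1) ^ 2 * (2 * v ω - t) ^ 2 := mul_pow _ _ _
    _ ≤ (2 * (L + 1)) * (8 * (w ω ^ 2 + K ^ 2)) := by gcongr
    _ = _ := by ring

theorem integrable_ratio_bound (hνμ : ν ≪ μ)
    (hwμ : Integrable (fun ω => w ω ^ 2) μ) (hwν : Integrable (fun ω => w ω ^ 2) ν) :
    Integrable (fun ω => ((ν.rnDeriv μ ω).toReal + 1) * (w ω ^ 2 + K ^ 2)) μ := by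
  have hL : Integrable (fun ω => (ν.rnDeriv μ ω).toReal) μ := Measure.integrable_toReal_rnDeriv
  have hLg : Integrable (fun ω => (ν.rnDeriv μ ω).toReal * w ω ^ 2) μ :=
    (integrable_rnDeriv_smul_iff hνμ).2 hwν
  refine ((hLg.add hwμ).add ((hL.const_mul (K ^ 2)).add (integrable_const (K ^ 2)))).congr
    (Eventually.of_forall fun ω => ?_)
  simp only [Pi.add_apply]
  ring

/-- Bayes' rule turns E_μ[L w² | m] into E_μ[L | m] E_ν[w² | m], so the moment bound under ν
replaces any bound on L. -/
theorem condExp_ratio_bound_le (hm : m ≤ m0) (hνμ : ν ≪ μ) (hμν : μ ≪ ν)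
    (hwμ : Integrable (fun ω => w ω ^ 2) μ) (hwν : Integrable (fun ω => w ω ^ 2) ν)
    (hwKμ : ∀ᵐ ω ∂μ, (μ[fun ω => w ω ^ 2 | m]) ω ≤ K ^ 2)
    (hwKν : ∀ᵐ ω ∂ν, (ν[fun ω => w ω ^ 2 | m]) ω ≤ K ^ 2) :
    ∀ᵐ ω ∂μ, (μ[fun ω => ((ν.rnDeriv μ ω).toReal + 1) * (w ω ^ 2 + K ^ 2) | m]) ω ≤
      2 * K ^ 2 * (1 + (μ[fun ω => (ν.rnDeriv μ ω).toReal | m]) ω) := by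
  have hL : Integrable (fun ω => (ν.rnDeriv μ ω).toReal) μ := Measure.integrable_toReal_rnDeriv
  have hLg : Integrable (fun ω => (ν.rnDeriv μ ω).toReal * w ω ^ 2) μ :=
    (integrable_rnDeriv_smul_iff hνμ).2 hwν
  have e : (fun ω => ((ν.rnDeriv μ ω).toReal + 1) * (w ω ^ 2 + K ^ 2)) =
      ((fun ω => (ν.rnDeriv μ ω).toReal * w ω ^ 2) + fun ω => w ω ^ 2) +
        ((K ^ 2) • (fun ω => (ν.rnDeriv μ ω).toReal) + fun _ => K ^ 2) := by
    ext ω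
    simp only [Pi.add_apply, Pi.smul_apply, smul_eq_mul]
    ring
  rw [e]
  filter_upwards [condExp_add (hLg.add hwμ) ((hL.smul (K ^ 2)).add (integrable_const (K ^ 2))) m,
    condExp_add hLg hwμ m, condExp_add (hL.smul (K ^ 2)) (integrable_const (K ^ 2)) m,
    condExp_smul (μ := μ) (K ^ 2) (fun ω => (ν.rnDeriv μ ω).toReal) m,
    condExp_rnDeriv_mul hm hνμ hwν, hwKμ, hμν hwKν, condExp_rnDeriv_nonneg (ν := ν) (μ := μ) (m := m)]
    with ω h1 h2 h3 h4 h5 h6 h7 h8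
  rw [h1, Pi.add_apply, h2, h3, Pi.add_apply, Pi.add_apply, h4, h5, condExp_const hm]
  simp only [Pi.smul_apply, smul_eq_mul]
  have := mul_le_mul_of_nonneg_left h7 h8
  linarith

theorem memLp_ratioFactor (hm : m ≤ m0) (hνμ : ν ≪ μ) (hμν : μ ≪ ν)
    (hv : AEStronglyMeasurable v μ)
    (hwμ : Integrable (fun ω => w ω ^ 2) μ) (hwν : Integrable (fun ω => w ω ^ 2) ν)
    (hvw : ∀ᵐ ω ∂μ, |v ω| ≤ w ω) (hK : 0 < K)
    (hwKμ : ∀ᵐ ω ∂μ, (μ[fun ω => w ω ^ 2 | m]) ω ≤ K ^ 2)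
    (hwKν : ∀ᵐ ω ∂ν, (ν[fun ω => w ω ^ 2 | m]) ω ≤ K ^ 2) :
    MemLp (ratioFactor m μ ν v) 2 μ := by
  have hmeas := aestronglyMeasurable_ratioFactor (ν := ν) hm hv
  rw [memLp_two_iff_integrable_sq hmeas]
  refine ((integrable_ratio_bound (K := K) hνμ hwμ hwν).const_mul 16).mono' (hmeas.pow 2) ?_
  filter_upwards [sq_ratioFactor_le hm hνμ hμν hwμ hwν hvw hK hwKμ hwKν,
    condExp_rnDeriv_nonneg (ν := ν) (μ := μ) (m := m)] with ω h1 h2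
  rw [Real.norm_of_nonneg (sq_nonneg _)]
  refine h1.trans ?_
  have h3 : (1 + (μ[fun ω => (ν.rnDeriv μ ω).toReal | m]) ω)⁻¹ ^ 2 ≤ 1 :=
    pow_le_one₀ (by positivity) (inv_le_one_of_one_le₀ (by linarith))
  have : 0 ≤ ((ν.rnDeriv μ ω).toReal + 1) * (w ω ^ 2 + K ^ 2) := by positivity
  exact mul_le_mul_of_nonneg_left (mul_le_of_le_one_left this h3) (by norm_num)

/-- With Λ = E_μ[L | m], the bound is 16 · 2K²(1 + Λ)/(1 + Λ)² ≤ 32K²: the normalising factor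
absorbs the growth of Λ, and the constant does not depend on ν. -/
theorem condExp_sq_ratioFactor_le (hm : m ≤ m0) (hνμ : ν ≪ μ) (hμν : μ ≪ ν)
    (hv : AEStronglyMeasurable v μ)
    (hwμ : Integrable (fun ω => w ω ^ 2) μ) (hwν : Integrable (fun ω => w ω ^ 2) ν)
    (hvw : ∀ᵐ ω ∂μ, |v ω| ≤ w ω) (hK : 0 < K)
    (hwKμ : ∀ᵐ ω ∂μ, (μ[fun ω => w ω ^ 2 | m]) ω ≤ K ^ 2)
    (hwKν : ∀ᵐ ω ∂ν, (ν[fun ω => w ω ^ 2 | m]) ω ≤ K ^ 2) :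
    ∀ᵐ ω ∂μ, (μ[fun ω => ratioFactor m μ ν v ω ^ 2 | m]) ω ≤ 32 * K ^ 2 := by
  have hG := integrable_ratio_bound (K := K) hνμ hwμ hwν
  have hBm : StronglyMeasurable[m]
      fun ω => (1 + (μ[fun ω => (ν.rnDeriv μ ω).toReal | m]) ω)⁻¹ ^ 2 :=
    ((measurable_const.add stronglyMeasurable_condExp.measurable).inv.pow_const 2).stronglyMeasurable
  have hB1 : ∀ᵐ ω ∂μ, ‖(1 + (μ[fun ω => (ν.rnDeriv μ ω).toReal | m]) ω)⁻¹ ^ 2‖ ≤ 1 := by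
    filter_upwards [condExp_rnDeriv_nonneg (ν := ν) (μ := μ) (m := m)] with ω h2
    rw [Real.norm_of_nonneg (sq_nonneg _)]
    exact pow_le_one₀ (by positivity) (inv_le_one_of_one_le₀ (by linarith))
  have hpull := condExp_stronglyMeasurable_mul_of_bound hm hBm hG 1 hB1
  have hBG : Integrable ((fun ω => (1 + (μ[fun ω => (ν.rnDeriv μ ω).toReal | m]) ω)⁻¹ ^ 2) *
      fun ω => ((ν.rnDeriv μ ω).toReal + 1) * (w ω ^ 2 + K ^ 2)) μ :=
    hG.bdd_mul (hBm.mono hm).aestronglyMeasurable hB1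
  have hmono := condExp_mono (m := m)
    (memLp_ratioFactor hm hνμ hμν hv hwμ hwν hvw hK hwKμ hwKν).integrable_sq
    (hBG.smul (16 : ℝ)) (sq_ratioFactor_le hm hνμ hμν hwμ hwν hvw hK hwKμ hwKν)
  filter_upwards [hmono, hpull, condExp_smul (μ := μ) (16 : ℝ)
    ((fun ω => (1 + (μ[fun ω => (ν.rnDeriv μ ω).toReal | m]) ω)⁻¹ ^ 2) *
      fun ω => ((ν.rnDeriv μ ω).toReal + 1) * (w ω ^ 2 + K ^ 2)) m,
    condExp_ratio_bound_le hm hνμ hμν hwμ hwν hwKμ hwKν,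
    condExp_rnDeriv_nonneg (ν := ν) (μ := μ) (m := m)] with ω h1 h2 h3 h4 h5
  refine h1.trans ?_
  rw [h3, Pi.smul_apply, h2, Pi.mul_apply, smul_eq_mul]
  set B := 1 + (μ[fun ω => (ν.rnDeriv μ ω).toReal | m]) ω with hB
  have hB1 : 1 ≤ B := by linarith
  calc 16 * (B⁻¹ ^ 2 * _) ≤ 16 * (B⁻¹ ^ 2 * (2 * K ^ 2 * B)) := by gcongr
    _ = 32 * K ^ 2 * B⁻¹ := by field_simp; ring
    _ ≤ 32 * K ^ 2 * 1 := by gcongr; exact inv_le_one_of_one_le₀ hB1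
    _ = 32 * K ^ 2 := mul_one _

/-- Change of a conditional mean under a change of measure, in terms of the root density. -/
theorem condExp_sub_condExp_eq (hm : m ≤ m0) (hνμ : ν ≪ μ) (hμν : μ ≪ ν)
    (hvμ : Integrable v μ) (hvν : Integrable v ν)
    (hKμ : ∀ᵐ ω ∂μ, |(μ[v | m]) ω| ≤ K) (hKν : ∀ᵐ ω ∂ν, |(ν[v | m]) ω| ≤ K) :
    (fun ω => (ν[v | m]) ω - (μ[v | m]) ω) =ᵐ[μ]
      μ[fun ω => (√(ν.rnDeriv μ ω).toReal - 1) * ratioFactor m μ ν v ω | m] := by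
  set L : Ω → ℝ := fun ω => (ν.rnDeriv μ ω).toReal with hLdef
  set τ : Ω → ℝ := fun ω => (μ[v | m]) ω + (ν[v | m]) ω with hτ
  have hL : Integrable L μ := Measure.integrable_toReal_rnDeriv
  have hLv : Integrable (fun ω => L ω * v ω) μ := (integrable_rnDeriv_smul_iff hνμ).2 hvν
  have hτm : StronglyMeasurable[m] τ := stronglyMeasurable_condExp.add stronglyMeasurable_condExp
  have hτb : ∀ᵐ ω ∂μ, ‖τ ω‖ ≤ 2 * K := by
    filter_upwards [hKμ, hμν hKν] with ω h1 h2
    exact (norm_add_le _ _).trans (by simp only [Real.norm_eq_abs]; linarith)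
  have hτi : Integrable τ μ := Integrable.of_bound (hτm.mono hm).aestronglyMeasurable _ hτb
  have hτL : Integrable (τ * L) μ := hL.bdd_mul (hτm.mono hm).aestronglyMeasurable hτb
  have hpullτ := condExp_stronglyMeasurable_mul_of_bound hm hτm hL _ hτb
  -- `H` is (L − 1)(2v − τ) expanded so that each term can be conditioned separately.
  set H : Ω → ℝ := ((2 : ℝ) • (fun ω => L ω * v ω) - τ * L) - ((2 : ℝ) • v - τ) with hH
  have hHi : Integrable H μ := ((hLv.smul _).sub hτL).sub ((hvμ.smul _).sub hτi)
  have hBm : StronglyMeasurable[m] fun ω => (1 + (μ[L | m]) ω)⁻¹ :=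
    ((measurable_const.add stronglyMeasurable_condExp.measurable).inv).stronglyMeasurable
  have hB1 : ∀ᵐ ω ∂μ, ‖(1 + (μ[L | m]) ω)⁻¹‖ ≤ 1 := by
    filter_upwards [condExp_rnDeriv_nonneg (ν := ν) (μ := μ) (m := m)] with ω h2
    rw [Real.norm_of_nonneg (by positivity)]
    exact inv_le_one_of_one_le₀ (by linarith)
  have hpull := condExp_stronglyMeasurable_mul_of_bound hm hBm hHi 1 hB1
  have e : (fun ω => (√(ν.rnDeriv μ ω).toReal - 1) * ratioFactor m μ ν v ω) =
      (fun ω => (1 + (μ[L | m]) ω)⁻¹) * H := by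
    ext ω
    simp only [ratioFactor, hH, Pi.mul_apply, Pi.sub_apply, Pi.smul_apply, smul_eq_mul]
    have hs : √(L ω) ^ 2 = L ω := Real.sq_sqrt ENNReal.toReal_nonneg
    change (√(L ω) - 1) * ((1 + (μ[L | m]) ω)⁻¹ * ((√(L ω) + 1) * (2 * v ω - τ ω))) = _
    linear_combination ((1 + (μ[L | m]) ω)⁻¹ * (2 * v ω - τ ω)) * hs
  rw [e]
  filter_upwards [hpull, condExp_sub ((hLv.smul (2 : ℝ)).sub hτL) ((hvμ.smul (2 : ℝ)).sub hτi) m,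
    condExp_sub (hLv.smul (2 : ℝ)) hτL m, condExp_sub (hvμ.smul (2 : ℝ)) hτi m,
    condExp_smul (μ := μ) (2 : ℝ) (fun ω => L ω * v ω) m, condExp_smul (μ := μ) (2 : ℝ) v m,
    hpullτ, condExp_rnDeriv_mul hm hνμ hvν,
    condExp_rnDeriv_nonneg (ν := ν) (μ := μ) (m := m)] with ω h1 h2 h3 h4 h5 h6 h7 h8 h9
  rw [h1, Pi.mul_apply, hH, h2, Pi.sub_apply, h3, h4, Pi.sub_apply, Pi.sub_apply, h5, h6, h7,
    condExp_of_stronglyMeasurable hm hτm hτi]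
  simp only [Pi.smul_apply, Pi.mul_apply, smul_eq_mul]
  rw [h8]
  have : (1 + (μ[L | m]) ω) ≠ 0 := by
    have : 0 ≤ (μ[L | m]) ω := h9
    positivity
  rw [eq_inv_mul_iff_mul_eq₀ this, hτ]
  ring

end LikelihoodRatio

/-! ### Passing to the limit inside a conditional mean of a product. -/

section Limits

variable {Ω : Type*} {m m0 : MeasurableSpace Ω} {μ : Measure Ω}

theorem ENNReal.tendsto_zero_of_le {ι : Type*} {l : Filter ι} {f g : ι → ℝ≥0∞}
    (hg : Tendsto g l (𝓝 0)) (h : ∀ i, f i ≤ g i) : Tendsto f l (𝓝 0) :=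
  tendsto_of_tendsto_of_tendsto_of_le_of_le tendsto_const_nhds hg (fun _ => zero_le) h

/-- Apply the one-sequence result to Σᵢ |Fᵢ|, which dominates every Fᵢ. -/
theorem exists_common_subseq_tendsto_ae {ι : Type*} [Fintype ι] {F : ι → ℕ → Ω → ℝ}
    (hF : ∀ i n, AEStronglyMeasurable (F i n) μ)
    (h : ∀ i, Tendsto (fun n => eLpNorm (F i n) 1 μ) atTop (𝓝 0)) :
    ∃ ns : ℕ → ℕ, StrictMono ns ∧
      ∀ᵐ ω ∂μ, ∀ i, Tendsto (fun n => F i (ns n) ω) atTop (𝓝 0) := by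
  have hS : Tendsto (fun n => eLpNorm ((∑ i, fun ω => ‖F i n ω‖) - 0) 1 μ) atTop (𝓝 0) := by
    have hsum : Tendsto (fun n => ∑ i, eLpNorm (F i n) 1 μ) atTop (𝓝 0) := by
      simpa using tendsto_finsetSum Finset.univ fun i _ => h i
    refine ENNReal.tendsto_zero_of_le hsum fun n => ?_
    rw [sub_zero]
    refine (eLpNorm_sum_le (fun i _ => (hF i n).norm) le_rfl).trans (le_of_eq ?_)
    exact Finset.sum_congr rfl fun i _ => eLpNorm_norm (F i n)
  obtain ⟨ns, hns, hae⟩ := (tendstoInMeasure_of_tendsto_eLpNorm one_ne_zero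
    (fun n => Finset.aestronglyMeasurable_sum _ fun i _ => (hF i n).norm)
    aestronglyMeasurable_const hS).exists_seq_tendsto_ae
  refine ⟨ns, hns, hae.mono fun ω hω i => ?_⟩
  refine squeeze_zero_norm (fun n => ?_) hω
  rw [Finset.sum_apply]
  exact Finset.single_le_sum (f := fun i => ‖F i (ns n) ω‖) (fun _ _ => norm_nonneg _)
    (Finset.mem_univ i)

theorem tendsto_eLpNorm_two_mul_zero {h : Ω → ℝ} {φ : ℕ → Ω → ℝ} (hh : MemLp h 2 μ)
    (hφm : ∀ n, AEStronglyMeasurable (φ n) μ) (hφ1 : ∀ n ω, |φ n ω| ≤ 1)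
    (hφ0 : ∀ᵐ ω ∂μ, Tendsto (fun n => φ n ω) atTop (𝓝 0)) :
    Tendsto (fun n => eLpNorm (fun ω => h ω * φ n ω) 2 μ) atTop (𝓝 0) := by
  simp_rw [eLpNorm_two_eq_lintegral_sq]
  have hlim : Tendsto (fun n => ∫⁻ ω, ENNReal.ofReal ((h ω * φ n ω) ^ 2) ∂μ) atTop (𝓝 0) := by
    have := tendsto_lintegral_of_dominated_convergence' (μ := μ)
      (F := fun n ω => ENNReal.ofReal ((h ω * φ n ω) ^ 2)) (f := fun _ => 0)
      (fun ω => ENNReal.ofReal (h ω ^ 2))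
      (fun n => ((hh.1.mul (hφm n)).aemeasurable.pow_const 2).ennreal_ofReal)
      (fun n => Eventually.of_forall fun ω => ENNReal.ofReal_le_ofReal ?_) ?_ ?_
    · simpa using this
    · rw [mul_pow]
      have : φ n ω ^ 2 ≤ 1 := by rw [← sq_abs]; exact pow_le_one₀ (abs_nonneg _) (hφ1 n ω)
      nlinarith [sq_nonneg (h ω)]
    · rw [← ofReal_integral_eq_lintegral_ofReal hh.integrable_sq
        (Eventually.of_forall fun ω => sq_nonneg _)]
      exact ENNReal.ofReal_ne_top
    · filter_upwards [hφ0] with ω hω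
      have : Tendsto (fun n => (h ω * φ n ω) ^ 2) atTop (𝓝 ((h ω * 0) ^ 2)) :=
        (hω.const_mul (h ω)).pow 2
      simpa [Function.comp_def] using (ENNReal.continuous_ofReal.tendsto _).comp this
  have := (ENNReal.continuous_rpow_const (y := (1 / 2 : ℝ))).tendsto 0 |>.comp hlim
  simpa [Function.comp_def, ENNReal.zero_rpow_of_pos] using this

theorem condExp_sq_sub_le {f g : Ω → ℝ} {c d : ℝ} (hf : MemLp f 2 μ)
    (hg : MemLp g 2 μ) (hfc : ∀ᵐ ω ∂μ, (μ[fun ω => f ω ^ 2 | m]) ω ≤ c)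
    (hgc : ∀ᵐ ω ∂μ, (μ[fun ω => g ω ^ 2 | m]) ω ≤ d) :
    ∀ᵐ ω ∂μ, (μ[fun ω => (f ω - g ω) ^ 2 | m]) ω ≤ 2 * c + 2 * d := by
  filter_upwards [condExp_mono (m := m) (hf.sub hg).integrable_sq
    ((hf.integrable_sq.smul (2 : ℝ)).add (hg.integrable_sq.smul (2 : ℝ)))
    (Eventually.of_forall fun ω => by
      simp only [Pi.sub_apply, Pi.add_apply, Pi.smul_apply, smul_eq_mul]
      nlinarith [sq_nonneg (f ω + g ω)]),
    condExp_add (hf.integrable_sq.smul (2 : ℝ)) (hg.integrable_sq.smul (2 : ℝ)) m,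
    condExp_smul (μ := μ) (2 : ℝ) (fun ω => f ω ^ 2) m,
    condExp_smul (μ := μ) (2 : ℝ) (fun ω => g ω ^ 2) m, hfc, hgc] with ω h1 h2 h3 h4 h5 h6
  rw [h2, Pi.add_apply, h3, h4] at h1
  simp only [Pi.smul_apply, smul_eq_mul] at h1
  refine h1.trans ?_
  linarith

variable [IsFiniteMeasure μ]

/-- Here g need not tend to 0 in L², so h g is not controlled directly. Factor g = φ₀(g) ψ₀(g) with
|φ₀| ≤ 1 and ψ₀² ≤ 1 + g². Dominated convergence sends h φ₀(g) to 0 in L², and conditional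
Cauchy–Schwarz handles the factor ψ₀(g). -/
theorem tendsto_eLpNorm_condExp_mul_zero (hm : m ≤ m0) {h : Ω → ℝ} {g : ℕ → Ω → ℝ} {c : ℝ}
    (hh : MemLp h 2 μ) (hg : ∀ n, MemLp (g n) 2 μ) (hc : 0 < c)
    (hgc : ∀ n, ∀ᵐ ω ∂μ, (μ[fun ω => g n ω ^ 2 | m]) ω ≤ c)
    (hg0 : ∀ᵐ ω ∂μ, Tendsto (fun n => g n ω) atTop (𝓝 0)) :
    Tendsto (fun n => eLpNorm (μ[fun ω => h ω * g n ω | m]) 2 μ) atTop (𝓝 0) := by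
  classical
  have hset : MeasurableSet {x : ℝ | |x| ≤ 1} := measurableSet_le (by fun_prop) (by fun_prop)
  set φ₀ : ℝ → ℝ := fun x => if |x| ≤ 1 then x else 1 with hφ₀
  set ψ₀ : ℝ → ℝ := fun x => if |x| ≤ 1 then 1 else x with hψ₀
  have hφm : Measurable φ₀ := Measurable.ite hset measurable_id measurable_const
  have hψm : Measurable ψ₀ := Measurable.ite hset measurable_const measurable_id
  have hφψ : ∀ x, φ₀ x * ψ₀ x = x := fun x => by
    by_cases hx : |x| ≤ 1 <;> simp [hφ₀, hψ₀, hx]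
  have hφ1 : ∀ x, |φ₀ x| ≤ 1 := fun x => by
    by_cases hx : |x| ≤ 1 <;> simp [hφ₀, hx]
  have hψ2 : ∀ x, ψ₀ x ^ 2 ≤ 1 + x ^ 2 := fun x => by
    by_cases hx : |x| ≤ 1
    · simp [hψ₀, hx, sq_nonneg]
    · simp [hψ₀, hx]
  have hφle : ∀ x, ‖φ₀ x‖ ≤ ‖x‖ := fun x => by
    by_cases hx : |x| ≤ 1
    · simp [hφ₀, hx]
    · simp [hφ₀, hx, (not_le.1 hx).le]
  have hφn : ∀ n, AEStronglyMeasurable (fun ω => φ₀ (g n ω)) μ := fun n =>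
    (hφm.comp_aemeasurable (hg n).1.aemeasurable).aestronglyMeasurable
  have hψn : ∀ n, AEStronglyMeasurable (fun ω => ψ₀ (g n ω)) μ := fun n =>
    (hψm.comp_aemeasurable (hg n).1.aemeasurable).aestronglyMeasurable
  have hint : ∀ n, Integrable ((fun _ => (1 : ℝ)) + fun ω => g n ω ^ 2) μ := fun n =>
    (integrable_const 1).add (hg n).integrable_sq
  have hψL : ∀ n, MemLp (fun ω => ψ₀ (g n ω)) 2 μ := fun n => by
    rw [memLp_two_iff_integrable_sq (hψn n)]
    refine (hint n).mono' ((hψn n).pow 2) (Eventually.of_forall fun ω => ?_)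
    rw [Real.norm_of_nonneg (sq_nonneg _)]
    exact hψ2 _
  have hψc : ∀ n, ∀ᵐ ω ∂μ, (μ[fun ω => ψ₀ (g n ω) ^ 2 | m]) ω ≤ 1 + c := fun n => by
    filter_upwards [condExp_mono (m := m) (hψL n).integrable_sq (hint n)
      (Eventually.of_forall fun ω => hψ2 (g n ω)), hgc n,
      condExp_add (integrable_const (1 : ℝ)) (hg n).integrable_sq m] with ω h1 h2 h3
    rw [h3, Pi.add_apply, condExp_const hm] at h1
    linarith
  have hhφ : ∀ n, MemLp (fun ω => h ω * φ₀ (g n ω)) 2 μ := fun n => by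
    refine hh.mono (hh.1.mul (hφn n)) (Eventually.of_forall fun ω => ?_)
    rw [norm_mul]
    exact mul_le_of_le_one_right (norm_nonneg _) (hφ1 _)
  have hlim := tendsto_eLpNorm_two_mul_zero hh hφn (fun n ω => hφ1 _) (by
    filter_upwards [hg0] with ω hω
    exact squeeze_zero_norm (fun n => hφle _) (tendsto_zero_iff_norm_tendsto_zero.1 hω))
  have hlim2 : Tendsto (fun n => ENNReal.ofReal (√(1 + c)) *
      eLpNorm (fun ω => h ω * φ₀ (g n ω)) 2 μ) atTop (𝓝 0) := by
    simpa using ENNReal.Tendsto.const_mul hlim (Or.inr ENNReal.ofReal_ne_top)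
  refine ENNReal.tendsto_zero_of_le hlim2 fun n => ?_
  have e : (fun ω => h ω * g n ω) = fun ω => h ω * φ₀ (g n ω) * ψ₀ (g n ω) := by
    ext ω; rw [mul_assoc, hφψ]
  rw [e]
  exact eLpNorm_condExp_mul_le hm (hhφ n) (hψL n) (by linarith) (hψc n)

/-- Use b g − h f = (b − h) g + h (g − f): the first term is small because b → h in L², the second
because g → f almost everywhere with bounded conditional second moments. -/
theorem tendsto_eLpNorm_condExp_mul_sub (hm : m ≤ m0) {h f : Ω → ℝ} {b g : ℕ → Ω → ℝ} {c : ℝ}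
    (hh : MemLp h 2 μ) (hb : ∀ n, MemLp (b n) 2 μ) (hg : ∀ n, MemLp (g n) 2 μ) (hf : MemLp f 2 μ)
    (hc : 0 < c) (hgc : ∀ n, ∀ᵐ ω ∂μ, (μ[fun ω => g n ω ^ 2 | m]) ω ≤ c)
    (hfc : ∀ᵐ ω ∂μ, (μ[fun ω => f ω ^ 2 | m]) ω ≤ c)
    (hbh : Tendsto (fun n => eLpNorm (fun ω => b n ω - h ω) 2 μ) atTop (𝓝 0))
    (hgf : ∀ᵐ ω ∂μ, Tendsto (fun n => g n ω) atTop (𝓝 (f ω))) :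
    Tendsto (fun n => eLpNorm (fun ω => (μ[fun ω => b n ω * g n ω | m]) ω
      - (μ[fun ω => h ω * f ω | m]) ω) 2 μ) atTop (𝓝 0) := by
  have hlim1 : Tendsto (fun n => ENNReal.ofReal (√c) * eLpNorm (fun ω => b n ω - h ω) 2 μ)
      atTop (𝓝 0) := by
    simpa using ENNReal.Tendsto.const_mul hbh (Or.inr ENNReal.ofReal_ne_top)
  have hlim2 := tendsto_eLpNorm_condExp_mul_zero (m := m) hm hh (fun n => (hg n).sub hf)
    (c := 2 * c + 2 * c) (by positivity) (fun n => condExp_sq_sub_le (hg n) hf (hgc n) hfc) (by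
      filter_upwards [hgf] with ω hω
      simpa using hω.sub_const (f ω))
  have hlim := hlim1.add hlim2
  rw [add_zero] at hlim
  refine ENNReal.tendsto_zero_of_le hlim fun n => ?_
  have hbhm : MemLp (fun ω => b n ω - h ω) 2 μ := (hb n).sub hh
  have hgfm : MemLp (fun ω => g n ω - f ω) 2 μ := (hg n).sub hf
  have e : (fun ω => (μ[fun ω => b n ω * g n ω | m]) ω - (μ[fun ω => h ω * f ω | m]) ω) =ᵐ[μ]
      μ[fun ω => (b n ω - h ω) * g n ω | m] + μ[fun ω => h ω * (g n ω - f ω) | m] := by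
    have h1 := condExp_sub (m := m) ((hb n).integrable_mul (hg n)) (hh.integrable_mul hf)
    have h2 := condExp_add (m := m) (hbhm.integrable_mul (hg n)) (hh.integrable_mul hgfm)
    refine h1.symm.trans (EventuallyEq.trans ?_ h2)
    refine condExp_congr_ae (Eventually.of_forall fun ω => ?_)
    simp only [Pi.sub_apply, Pi.add_apply, Pi.mul_apply]
    ring
  rw [eLpNorm_congr_ae e]
  refine (eLpNorm_add_le (stronglyMeasurable_condExp.mono hm).aestronglyMeasurable
    (stronglyMeasurable_condExp.mono hm).aestronglyMeasurable one_le_two).trans ?_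
  gcongr
  · exact eLpNorm_condExp_mul_le hm hbhm (hg n) hc (hgc n)
  · exact le_rfl

end Limits

/-! ### The difference quotient of the conditional mean along a differentiable path of measures. -/

section DifferenceQuotient

variable {Ω : Type*} {m m0 : MeasurableSpace Ω} {μ : Measure Ω}

theorem memLp_two_of_abs_le {v w : Ω → ℝ} (hv : AEStronglyMeasurable v μ)
    (hw : Integrable (fun ω => w ω ^ 2) μ) (hvw : ∀ᵐ ω ∂μ, |v ω| ≤ w ω) : MemLp v 2 μ := by
  rw [memLp_two_iff_integrable_sq hv]
  refine hw.mono' (hv.pow 2) ?_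
  filter_upwards [hvw] with ω hω
  rw [Real.norm_of_nonneg (sq_nonneg _), ← sq_abs]
  gcongr

theorem condExp_sq_le_of_abs_le {v w : Ω → ℝ} {c : ℝ} (hv : AEStronglyMeasurable v μ)
    (hw : Integrable (fun ω => w ω ^ 2) μ) (hvw : ∀ᵐ ω ∂μ, |v ω| ≤ w ω)
    (hwc : ∀ᵐ ω ∂μ, (μ[fun ω => w ω ^ 2 | m]) ω ≤ c) :
    ∀ᵐ ω ∂μ, (μ[fun ω => v ω ^ 2 | m]) ω ≤ c := by
  filter_upwards [hwc, condExp_mono (m := m) (memLp_two_of_abs_le hv hw hvw).integrable_sq hw (by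
    filter_upwards [hvw] with ω hω
    rw [← sq_abs]
    gcongr)] with ω h1 h2
  exact h2.trans h1

/-- The residual of the conditional mean has a bounded conditional second moment. -/
theorem condExp_sq_residual_le (hm : m ≤ m0) [IsFiniteMeasure μ] {v w : Ω → ℝ} {K : ℝ}
    (hv : AEStronglyMeasurable v μ) (hw : Integrable (fun ω => w ω ^ 2) μ)
    (hvw : ∀ᵐ ω ∂μ, |v ω| ≤ w ω) (hK : 0 < K)
    (hwK : ∀ᵐ ω ∂μ, (μ[fun ω => w ω ^ 2 | m]) ω ≤ K ^ 2) :
    ∀ᵐ ω ∂μ, (μ[fun ω => (v ω - (μ[v | m]) ω) ^ 2 | m]) ω ≤ 4 * K ^ 2 := by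
  have hvL := memLp_two_of_abs_le hv hw hvw
  have hθ : ∀ᵐ ω ∂μ, (μ[fun ω => (μ[v | m]) ω ^ 2 | m]) ω ≤ K ^ 2 := by
    refine condExp_le_nonneg_const (sq_nonneg K) ?_
    filter_upwards [abs_condExp_le_of_condExp_sq_le hm hw hvw hK hwK] with ω hω
    rw [← sq_abs]
    gcongr
  filter_upwards [condExp_sq_sub_le hvL (hvL.condExp one_le_two)
    (condExp_sq_le_of_abs_le hv hw hvw hwK) hθ] with ω hω
  linarith

theorem memLp_sqrt_rnDeriv [SigmaFinite μ] (ν : Measure Ω) [IsFiniteMeasure ν] :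
    MemLp (fun ω => √(ν.rnDeriv μ ω).toReal) 2 μ := by
  have hmeas : Measurable fun ω => √(ν.rnDeriv μ ω).toReal := by fun_prop
  rw [memLp_two_iff_integrable_sq hmeas.aestronglyMeasurable]
  refine (Measure.integrable_toReal_rnDeriv (μ := ν) (ν := μ)).congr (Eventually.of_forall fun ω => ?_)
  exact (Real.sq_sqrt ENNReal.toReal_nonneg).symm

variable [IsProbabilityMeasure μ] {ν : ℕ → Measure Ω} [∀ n, IsFiniteMeasure (ν n)]

/-- With a = √L − 1 one has L − 1 = a(a + 2), and Hölder's inequality applies. This gives E_μ[L | m]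
→ 1 in L¹ from convergence of the root density. -/
theorem eLpNorm_rnDeriv_sub_one_le (ν : Measure Ω) [IsFiniteMeasure ν] :
    eLpNorm (fun ω => (ν.rnDeriv μ ω).toReal - 1) 1 μ ≤
      eLpNorm (fun ω => √(ν.rnDeriv μ ω).toReal - 1) 2 μ *
        (eLpNorm (fun ω => √(ν.rnDeriv μ ω).toReal - 1) 2 μ + 2) := by
  set a : Ω → ℝ := fun ω => √(ν.rnDeriv μ ω).toReal - 1 with ha
  have ham : AEStronglyMeasurable a μ := ((memLp_sqrt_rnDeriv (μ := μ) ν).sub (memLp_const 1)).1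
  have e : (fun ω => (ν.rnDeriv μ ω).toReal - 1) = a • (a + fun _ => 2) := by
    ext ω
    have hs : √(ν.rnDeriv μ ω).toReal ^ 2 = _ := Real.sq_sqrt ENNReal.toReal_nonneg
    simp only [ha, Pi.smul_apply', Pi.add_apply, smul_eq_mul]
    linear_combination -hs
  rw [e]
  refine (eLpNorm_smul_le_mul_eLpNorm (p := 2) (q := 2) (r := 1)
    (ham.add aestronglyMeasurable_const) ham).trans ?_
  gcongr
  refine (eLpNorm_add_le ham aestronglyMeasurable_const one_le_two).trans ?_
  gcongr
  rw [eLpNorm_const _ two_ne_zero (IsProbabilityMeasure.ne_zero μ)]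
  simp [Real.enorm_eq_ofReal]

/-- The conditional mean of `v n` has the stated difference quotient under a change of measure
that is differentiable in quadratic mean. -/
theorem tendsto_condExp_differenceQuotient (hm : m ≤ m0)
    (hνμ : ∀ n, ν n ≪ μ) (hμν : ∀ n, μ ≪ ν n) {u w h : Ω → ℝ} {v : ℕ → Ω → ℝ} {ε : ℕ → ℝ} {K : ℝ}
    (hv : ∀ n, AEStronglyMeasurable (v n) μ) (hu : AEStronglyMeasurable u μ)
    (hwμ : Integrable (fun ω => w ω ^ 2) μ) (hwν : ∀ n, Integrable (fun ω => w ω ^ 2) (ν n))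
    (hvw : ∀ n, ∀ᵐ ω ∂μ, |v n ω| ≤ w ω) (huw : ∀ᵐ ω ∂μ, |u ω| ≤ w ω) (hK : 0 < K)
    (hwKμ : ∀ᵐ ω ∂μ, (μ[fun ω => w ω ^ 2 | m]) ω ≤ K ^ 2)
    (hwKν : ∀ n, ∀ᵐ ω ∂(ν n), ((ν n)[fun ω => w ω ^ 2 | m]) ω ≤ K ^ 2)
    (hε : Tendsto ε atTop (𝓝 0)) (hεne : ∀ n, ε n ≠ 0) (hh : MemLp h 2 μ)
    (hqmd : Tendsto (fun n => eLpNorm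
      (fun ω => (ε n)⁻¹ * (√((ν n).rnDeriv μ ω).toReal - 1) - h ω) 2 μ) atTop (𝓝 0))
    (hvu : Tendsto (fun n => eLpNorm (fun ω => v n ω - u ω) 2 μ) atTop (𝓝 0)) :
    Tendsto (fun n => eLpNorm (fun ω => (ε n)⁻¹ * (((ν n)[v n | m]) ω - (μ[v n | m]) ω)
      - (μ[fun ω => h ω * (2 * (u ω - (μ[u | m]) ω)) | m]) ω) 2 μ) atTop (𝓝 0) := by
  have hvL : ∀ n, MemLp (v n) 2 μ := fun n => memLp_two_of_abs_le (hv n) hwμ (hvw n)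
  have huL : MemLp u 2 μ := memLp_two_of_abs_le hu hwμ huw
  have hvν : ∀ n, Integrable (v n) (ν n) := fun n =>
    (memLp_two_of_abs_le ((hv n).mono_ac (hνμ n)) (hwν n) (hνμ n (hvw n))).integrable one_le_two
  have hfL : ∀ n, MemLp (ratioFactor m μ (ν n) (v n)) 2 μ := fun n =>
    memLp_ratioFactor hm (hνμ n) (hμν n) (hv n) hwμ (hwν n) (hvw n) hK hwKμ (hwKν n)
  have hfc : ∀ n, ∀ᵐ ω ∂μ, (μ[fun ω => ratioFactor m μ (ν n) (v n) ω ^ 2 | m]) ω ≤ 32 * K ^ 2 :=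
    fun n => condExp_sq_ratioFactor_le hm (hνμ n) (hμν n) (hv n) hwμ (hwν n) (hvw n) hK hwKμ (hwKν n)
  have haL : ∀ n, MemLp (fun ω => √((ν n).rnDeriv μ ω).toReal - 1) 2 μ := fun n =>
    (memLp_sqrt_rnDeriv (ν n)).sub (memLp_const 1)
  have hbL : ∀ n, MemLp (fun ω => (ε n)⁻¹ * (√((ν n).rnDeriv μ ω).toReal - 1)) 2 μ := fun n =>
    (haL n).const_mul _
  have hdiff : ∀ n, (fun ω => ((ν n)[v n | m]) ω - (μ[v n | m]) ω) =ᵐ[μ]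
      μ[fun ω => (√((ν n).rnDeriv μ ω).toReal - 1) * ratioFactor m μ (ν n) (v n) ω | m] := fun n =>
    condExp_sub_condExp_eq hm (hνμ n) (hμν n) ((hvL n).integrable one_le_two) (hvν n)
      (abs_condExp_le_of_condExp_sq_le hm hwμ (hvw n) hK hwKμ)
      (abs_condExp_le_of_condExp_sq_le hm (hwν n) (hνμ n (hvw n)) hK (hwKν n))
  have hquot : ∀ n, (fun ω => (ε n)⁻¹ * (((ν n)[v n | m]) ω - (μ[v n | m]) ω)) =ᵐ[μ]
      μ[fun ω => ((ε n)⁻¹ * (√((ν n).rnDeriv μ ω).toReal - 1)) *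
        ratioFactor m μ (ν n) (v n) ω | m] := fun n => by
    have e : (fun ω => ((ε n)⁻¹ * (√((ν n).rnDeriv μ ω).toReal - 1)) *
        ratioFactor m μ (ν n) (v n) ω) =
        (ε n)⁻¹ • fun ω => (√((ν n).rnDeriv μ ω).toReal - 1) * ratioFactor m μ (ν n) (v n) ω := by
      ext ω
      simp only [Pi.smul_apply, smul_eq_mul]
      ring
    rw [e]
    filter_upwards [hdiff n, condExp_smul (μ := μ) (ε n)⁻¹ (fun ω =>
      (√((ν n).rnDeriv μ ω).toReal - 1) * ratioFactor m μ (ν n) (v n) ω) m] with ω h1 h2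
    rw [h2, h1]
    rfl
  -- the root density ratio tends to one
  have ha0 : Tendsto (fun n => eLpNorm (fun ω => √((ν n).rnDeriv μ ω).toReal - 1) 2 μ)
      atTop (𝓝 0) := by
    have hlim : Tendsto (fun n => ‖ε n‖ₑ * (eLpNorm
        (fun ω => (ε n)⁻¹ * (√((ν n).rnDeriv μ ω).toReal - 1) - h ω) 2 μ + eLpNorm h 2 μ))
        atTop (𝓝 (0 * (0 + eLpNorm h 2 μ))) := by
      refine ENNReal.Tendsto.mul ?_ (Or.inr (by simpa using hh.2.ne))
        (hqmd.add tendsto_const_nhds) (Or.inr ENNReal.zero_ne_top)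
      simpa [Function.comp_def] using (continuous_enorm.tendsto (0 : ℝ)).comp hε
    rw [zero_mul] at hlim
    refine ENNReal.tendsto_zero_of_le hlim fun n => ?_
    have e : (fun ω => √((ν n).rnDeriv μ ω).toReal - 1) = ε n •
        ((fun ω => (ε n)⁻¹ * (√((ν n).rnDeriv μ ω).toReal - 1) - h ω) + h) := by
      ext ω
      simp only [Pi.smul_apply, Pi.add_apply, smul_eq_mul, sub_add_cancel]
      rw [mul_inv_cancel_left₀ (hεne n)]
    conv_lhs => rw [e]
    rw [eLpNorm_const_smul]
    gcongr
    exact eLpNorm_add_le ((hbL n).sub hh).1 hh.1 one_le_two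
  have h21 : ∀ {f : ℕ → Ω → ℝ}, (∀ n, AEStronglyMeasurable (f n) μ) →
      Tendsto (fun n => eLpNorm (f n) 2 μ) atTop (𝓝 0) →
      Tendsto (fun n => eLpNorm (f n) 1 μ) atTop (𝓝 0) := fun hf h =>
    ENNReal.tendsto_zero_of_le h fun n => eLpNorm_le_eLpNorm_of_exponent_le one_le_two (hf n)
  have hcm : ∀ {ρ : Measure Ω} {f : Ω → ℝ}, AEStronglyMeasurable (ρ[f | m]) μ := fun {ρ f} =>
    (stronglyMeasurable_condExp.mono hm).aestronglyMeasurable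
  have hθ0 : Tendsto (fun n => eLpNorm (fun ω => (μ[v n | m]) ω - (μ[u | m]) ω) 2 μ)
      atTop (𝓝 0) := by
    refine ENNReal.tendsto_zero_of_le hvu fun n => ?_
    exact (eLpNorm_congr_ae (condExp_sub ((hvL n).integrable one_le_two)
      (huL.integrable one_le_two) m)).symm.trans_le (eLpNorm_condExp_le_eLpNorm _ one_le_two)
  have hθ'0 : Tendsto (fun n => eLpNorm (fun ω => ((ν n)[v n | m]) ω - (μ[v n | m]) ω) 2 μ)
      atTop (𝓝 0) := by
    have hlim := ENNReal.Tendsto.const_mul (a := ENNReal.ofReal (√(32 * K ^ 2))) ha0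
      (Or.inr ENNReal.ofReal_ne_top)
    rw [mul_zero] at hlim
    refine ENNReal.tendsto_zero_of_le hlim fun n => ?_
    rw [eLpNorm_congr_ae (hdiff n)]
    exact eLpNorm_condExp_mul_le hm (haL n) (hfL n) (by positivity) (hfc n)
  have hL0 : Tendsto (fun n => eLpNorm
      (fun ω => (μ[fun ω => ((ν n).rnDeriv μ ω).toReal | m]) ω - 1) 1 μ) atTop (𝓝 0) := by
    have hlim : Tendsto (fun n => eLpNorm (fun ω => √((ν n).rnDeriv μ ω).toReal - 1) 2 μ *
        (eLpNorm (fun ω => √((ν n).rnDeriv μ ω).toReal - 1) 2 μ + 2)) atTop (𝓝 (0 * (0 + 2))) :=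
      ENNReal.Tendsto.mul ha0 (Or.inr (by simp)) (ha0.add tendsto_const_nhds)
        (Or.inr ENNReal.zero_ne_top)
    rw [zero_mul] at hlim
    refine ENNReal.tendsto_zero_of_le hlim fun n => ?_
    refine le_trans ?_ (eLpNorm_rnDeriv_sub_one_le (ν n))
    have e := condExp_sub (μ := μ) (Measure.integrable_toReal_rnDeriv (μ := ν n) (ν := μ))
      (integrable_const (1 : ℝ)) m
    rw [condExp_const hm] at e
    exact (eLpNorm_congr_ae e).symm.trans_le (eLpNorm_condExp_le_eLpNorm _ le_rfl)
  -- Almost everywhere convergence of the ratio factors is available only along further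
  -- subsequences, which is enough for convergence of the norms.
  refine tendsto_of_subseq_tendsto fun ns hns => ?_
  -- The five null sequences from which the ratio factor is built.
  set F : Fin 5 → ℕ → Ω → ℝ := fun i n => ![fun ω => √((ν n).rnDeriv μ ω).toReal - 1,
    fun ω => v n ω - u ω, fun ω => (μ[v n | m]) ω - (μ[u | m]) ω,
    fun ω => ((ν n)[v n | m]) ω - (μ[v n | m]) ω,
    fun ω => (μ[fun ω => ((ν n).rnDeriv μ ω).toReal | m]) ω - 1] i with hF
  have hFm : ∀ i n, AEStronglyMeasurable (F i n) μ := by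
    intro i n
    fin_cases i
    · exact (haL n).1
    · exact (hv n).sub hu
    · exact hcm.sub hcm
    · exact hcm.sub hcm
    · exact hcm.sub aestronglyMeasurable_const
  have hF0 : ∀ i, Tendsto (fun n => eLpNorm (F i n) 1 μ) atTop (𝓝 0) := by
    intro i
    fin_cases i
    · exact h21 (fun n => (haL n).1) ha0
    · exact h21 (fun n => (hv n).sub hu) hvu
    · exact h21 (fun n => hcm.sub hcm) hθ0
    · exact h21 (fun n => hcm.sub hcm) hθ'0
    · exact hL0
  obtain ⟨ms, hmono, hms⟩ := exists_common_subseq_tendsto_ae (F := fun i n => F i (ns n))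
    (fun i n => hFm i _) (fun i => (hF0 i).comp hns)
  refine ⟨ms, ?_⟩
  have hsub : Tendsto (fun n => ns (ms n)) atTop atTop := hns.comp hmono.tendsto_atTop
  have hresL : MemLp (fun ω => u ω - (μ[u | m]) ω) 2 μ := huL.sub (huL.condExp one_le_two)
  have hlimc : ∀ᵐ ω ∂μ, (μ[fun ω => (2 * (u ω - (μ[u | m]) ω)) ^ 2 | m]) ω ≤ 32 * K ^ 2 := by
    have e : (fun ω => (2 * (u ω - (μ[u | m]) ω)) ^ 2) =
        (4 : ℝ) • fun ω => (u ω - (μ[u | m]) ω) ^ 2 := by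
      ext ω
      simp only [Pi.smul_apply, smul_eq_mul]
      ring
    rw [e]
    filter_upwards [condExp_smul (μ := μ) (4 : ℝ) (fun ω => (u ω - (μ[u | m]) ω) ^ 2) m,
      condExp_sq_residual_le hm hu hwμ huw hK hwKμ] with ω h1 h2
    rw [h1, Pi.smul_apply, smul_eq_mul]
    nlinarith [sq_nonneg K]
  have hfinal := tendsto_eLpNorm_condExp_mul_sub (m := m) hm hh
    (fun n => hbL (ns (ms n))) (fun n => hfL (ns (ms n))) (hresL.const_mul 2)
    (by positivity : (0 : ℝ) < 32 * K ^ 2) (fun n => hfc _) hlimc (hqmd.comp hsub) (by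
      filter_upwards [hms] with ω hω
      have h0 : Tendsto (fun n => √((ν (ns (ms n))).rnDeriv μ ω).toReal - 1) atTop (𝓝 0) := hω 0
      have h1 : Tendsto (fun n => v (ns (ms n)) ω - u ω) atTop (𝓝 0) := hω 1
      have h2 : Tendsto (fun n => (μ[v (ns (ms n)) | m]) ω - (μ[u | m]) ω) atTop (𝓝 0) := hω 2
      have h3 : Tendsto (fun n => ((ν (ns (ms n)))[v (ns (ms n)) | m]) ω -
        (μ[v (ns (ms n)) | m]) ω) atTop (𝓝 0) := hω 3
      have h4 : Tendsto (fun n => (μ[fun ω => ((ν (ns (ms n))).rnDeriv μ ω).toReal | m]) ω - 1)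
        atTop (𝓝 0) := hω 4
      have hB : Tendsto (fun n => (2 + ((μ[fun ω => ((ν (ns (ms n))).rnDeriv μ ω).toReal | m]) ω
          - 1))⁻¹) atTop (𝓝 (2 + 0)⁻¹) := (h4.const_add 2).inv₀ (by norm_num)
      have hprod := hB.mul ((h0.add_const 2).mul
        ((((h1.add_const (u ω)).const_mul 2).sub ((h2.const_mul 2).add h3)).sub_const
          (2 * (μ[u | m]) ω)))
      -- At the limit the normalisation 1/2 cancels √L + 1 = 2, leaving twice the residual of u.
      have hval : (2 + 0 : ℝ)⁻¹ * ((0 + 2) * (2 * (0 + u ω) - (2 * 0 + 0) - 2 * (μ[u | m]) ω)) =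
        2 * (u ω - (μ[u | m]) ω) := by ring
      rw [hval] at hprod
      refine hprod.congr fun n => ?_
      rw [ratioFactor]
      congr 1
      · congr 1; ring
      · ring)
  refine hfinal.congr fun n => eLpNorm_congr_ae ?_
  filter_upwards [hquot (ns (ms n))] with ω hω
  rw [← hω]

end DifferenceQuotient

/-! ### Densities of product laws and the tensor product of L² functions. -/

section ProductLaw

variable {S T : Type*} [MeasurableSpace S] [MeasurableSpace T] {r : ℕ} {μ ν : Measure S}

/-- Tonelli, by induction on r, splitting off coordinate 0. -/
theorem lintegral_iidLaw_prod [SigmaFinite μ] {f : Fin r → S → ℝ≥0∞} (hf : ∀ i, Measurable (f i)) :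
    ∫⁻ z, ∏ i, f i (z i) ∂(iidLaw r μ) = ∏ i, ∫⁻ z, f i z ∂μ := by
  induction r with
  | zero => simp
  | succ n ih =>
    have hmp := (measurePreserving_piFinSuccAbove (fun _ : Fin (n + 1) => μ) 0).symm
    rw [iidLaw, ← hmp.lintegral_comp (by fun_prop)]
    have e : ∀ x : S × (Fin n → S), ∏ i, f i
        ((MeasurableEquiv.piFinSuccAbove (fun _ : Fin (n + 1) => S) 0).symm x i) =
        f 0 x.1 * ∏ i : Fin n, f i.succ (x.2 i) := fun x => by
      rw [Fin.prod_univ_succ]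
      rfl
    simp_rw [e]
    rw [lintegral_prod_mul (g := fun z : Fin n → S => ∏ i, f i.succ (z i)) (hf 0).aemeasurable
      (Finset.measurable_prod _ fun i _ =>
        (hf i.succ).comp (measurable_pi_apply i)).aemeasurable, Fin.prod_univ_succ]
    congr 1
    exact ih fun i => hf i.succ

theorem iidLaw_withDensity [IsProbabilityMeasure μ] {L : S → ℝ≥0∞} (hL : Measurable L)
    [IsProbabilityMeasure (μ.withDensity L)] :
    iidLaw r (μ.withDensity L) = (iidLaw r μ).withDensity fun z => ∏ i, L (z i) := by
  classical
  refine (Measure.pi_eq fun s hs => ?_)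
  rw [withDensity_apply _ (MeasurableSet.univ_pi hs), ← lintegral_indicator (MeasurableSet.univ_pi hs)]
  have e : (Set.univ.pi s).indicator (fun z : Fin r → S => ∏ i, L (z i)) =
      fun z => ∏ i, (s i).indicator L (z i) := by
    ext z
    by_cases hz : z ∈ Set.univ.pi s
    · rw [Set.indicator_of_mem hz]
      exact Finset.prod_congr rfl fun i _ => (Set.indicator_of_mem (hz i trivial) _).symm
    · rw [Set.indicator_of_notMem hz]
      simp only [Set.mem_pi, Set.mem_univ, true_imp_iff, not_forall] at hz
      obtain ⟨i, hi⟩ := hz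
      exact (Finset.prod_eq_zero (Finset.mem_univ i) (Set.indicator_of_notMem hi _)).symm
  rw [e, lintegral_iidLaw_prod fun i => hL.indicator (hs i)]
  exact Finset.prod_congr rfl fun i _ => by
    rw [lintegral_indicator (hs i), withDensity_apply _ (hs i)]

theorem prod_update_coeFn [DecidableEq (Fin r)] (f : Fin r → Lp ℝ 2 μ) (i : Fin r) (x : Lp ℝ 2 μ)
    (z : Fin r → S) :
    ∏ j, (Function.update f i x j) (z j) = x (z i) * ∏ j ∈ Finset.univ.erase i, f j (z j) := by
  rw [← Finset.mul_prod_erase _ _ (Finset.mem_univ i), Function.update_self]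
  congr 1
  exact Finset.prod_congr rfl fun j hj => by rw [Function.update_of_ne (Finset.ne_of_mem_erase hj)]

variable [IsProbabilityMeasure μ] [IsProbabilityMeasure ν]

theorem iidLaw_eq_withDensity (hνμ : ν ≪ μ) :
    iidLaw r ν = (iidLaw r μ).withDensity fun z => ∏ i, ν.rnDeriv μ (z i) := by
  have h := Measure.withDensity_rnDeriv_eq ν μ hνμ
  have : IsProbabilityMeasure (μ.withDensity (ν.rnDeriv μ)) := by rw [h]; infer_instance
  rw [← iidLaw_withDensity (Measure.measurable_rnDeriv ν μ), h]

theorem iidLaw_absolutelyContinuous (hνμ : ν ≪ μ) : iidLaw r ν ≪ iidLaw r μ := by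
  rw [iidLaw_eq_withDensity hνμ]
  exact withDensity_absolutelyContinuous _ _

theorem rnDeriv_iidLaw (hνμ : ν ≪ μ) :
    (iidLaw r ν).rnDeriv (iidLaw r μ) =ᵐ[iidLaw r μ] fun z => ∏ i, ν.rnDeriv μ (z i) := by
  rw [iidLaw_eq_withDensity (r := r) hνμ]
  exact Measure.rnDeriv_withDensity _ (by fun_prop)

theorem ae_iidLaw_eval {p : S → Prop} (hp : ∀ᵐ x ∂μ, p x) :
    ∀ᵐ z ∂(iidLaw r μ), ∀ i, p (z i) :=
  ae_all_iff.2 fun i =>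
    (measurePreserving_eval (fun _ : Fin r => μ) i).quasiMeasurePreserving.ae hp

/-- Each of the r factors of the product density is at most its essential supremum. This domination
is what allows L² norms to be moved between the laws of P and Q. -/
theorem iidLaw_le_smul (hνμ : ν ≪ μ) :
    iidLaw r ν ≤ (essSup (ν.rnDeriv μ) μ) ^ r • iidLaw r μ := by
  rw [iidLaw_eq_withDensity (r := r) hνμ, ← withDensity_const]
  refine withDensity_mono ?_
  filter_upwards [ae_iidLaw_eval (r := r) (ENNReal.ae_le_essSup (ν.rnDeriv μ) (μ := μ))] with z hz
  refine (Finset.prod_le_prod' fun i _ => hz i).trans (le_of_eq ?_)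
  simp

theorem map_coarsen_iidLaw {C : S → T} (hC : Measurable C) :
    (iidLaw r μ).map (coarsen C r) = iidLaw r (μ.map C) := by
  have : IsProbabilityMeasure (μ.map C) := Measure.isProbabilityMeasure_map hC.aemeasurable
  exact Measure.pi_map_pi fun _ => hC.aemeasurable

theorem measurable_coarsen {C : S → T} (hC : Measurable C) : Measurable (coarsen C r) :=
  measurable_pi_lambda _ fun i => hC.comp (measurable_pi_apply i)

theorem eLpNorm_iidLaw_prod {f : Fin r → S → ℝ} (hf : ∀ i, Measurable (f i)) :
    eLpNorm (fun z => ∏ i, f i (z i)) 2 (iidLaw r μ) = ∏ i, eLpNorm (f i) 2 μ := by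
  simp_rw [eLpNorm_two_eq_lintegral_sq]
  rw [ENNReal.prod_rpow_of_nonneg (by norm_num), ← lintegral_iidLaw_prod (by fun_prop)]
  congr 2
  ext z
  rw [← ENNReal.ofReal_prod_of_nonneg fun i _ => sq_nonneg _, Finset.prod_pow]

theorem memLp_iidLaw_prod {f : Fin r → S → ℝ} (hf : ∀ i, Measurable (f i))
    (hfL : ∀ i, MemLp (f i) 2 μ) : MemLp (fun z => ∏ i, f i (z i)) 2 (iidLaw r μ) := by
  refine ⟨(by fun_prop : Measurable fun z : Fin r → S => ∏ i, f i (z i)).aestronglyMeasurable, ?_⟩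
  rw [eLpNorm_iidLaw_prod hf]
  exact ENNReal.prod_lt_top fun i _ => (hfL i).2

/-- The tensor product `(f₁, …, f_r) ↦ f₁(z₁) ⋯ f_r(z_r)` from `L²(μ)` to `L²(μ^r)`. -/
noncomputable def tensorL2 (r : ℕ) (μ : Measure S) [IsProbabilityMeasure μ] :
    ContinuousMultilinearMap ℝ (fun _ : Fin r => Lp ℝ 2 μ) (Lp ℝ 2 (iidLaw r μ)) :=
  MultilinearMap.mkContinuous
    { toFun := fun f => (memLp_iidLaw_prod (fun i => (Lp.stronglyMeasurable (f i)).measurable)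
        fun i => Lp.memLp (f i)).toLp _
      map_update_add' := by
        intro _ f i x y
        rw [← MemLp.toLp_add, MemLp.toLp_eq_toLp_iff]
        filter_upwards [ae_iidLaw_eval (r := r) (Lp.coeFn_add x y)] with z hz
        simp only [Pi.add_apply, prod_update_coeFn, hz i, add_mul]
      map_update_smul' := by
        intro _ f i c x
        rw [← MemLp.toLp_const_smul, MemLp.toLp_eq_toLp_iff]
        filter_upwards [ae_iidLaw_eval (r := r) (Lp.coeFn_smul c x)] with z hz
        simp only [Pi.smul_apply, prod_update_coeFn, hz i, smul_eq_mul, mul_assoc] }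
    1 (fun f => by
      simp only [MultilinearMap.coe_mk, Lp.norm_toLp, one_mul]
      rw [eLpNorm_iidLaw_prod fun i => (Lp.stronglyMeasurable (f i)).measurable,
        ENNReal.toReal_prod]
      exact le_of_eq (Finset.prod_congr rfl fun i _ => (Lp.norm_def _).symm))

theorem coeFn_tensorL2 (f : Fin r → Lp ℝ 2 μ) :
    tensorL2 r μ f =ᵐ[iidLaw r μ] fun z => ∏ i, f i (z i) :=
  MemLp.coeFn_toLp (memLp_iidLaw_prod (fun i => (Lp.stronglyMeasurable (f i)).measurable)
    fun i => Lp.memLp (f i))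

end ProductLaw

/-! ### Root densities along a path, and the score of the product law. -/

section RootDensity

variable {S : Type*} [MeasurableSpace S] {r : ℕ}

/-- The root density of `ν` with respect to `μ`, as an element of `L²(μ)`. -/
noncomputable def rootDensity (μ ν : Measure S) [SigmaFinite μ] [IsFiniteMeasure ν] : Lp ℝ 2 μ :=
  (memLp_sqrt_rnDeriv (μ := μ) ν).toLp _

theorem coeFn_rootDensity (μ ν : Measure S) [SigmaFinite μ] [IsFiniteMeasure ν] :
    rootDensity μ ν =ᵐ[μ] fun z => √(ν.rnDeriv μ z).toReal :=
  MemLp.coeFn_toLp _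

/-- The integral in the definition of differentiability in quadratic mean does not depend on the
dominating measure. -/
theorem integral_qmd_eq {μ ν : Measure S} [IsFiniteMeasure μ] [IsFiniteMeasure ν] (hνμ : ν ≪ μ)
    (c : ℝ) (s : S → ℝ) :
    ∫ z, (√((ν.rnDeriv (μ + ν) z).toReal) - √((μ.rnDeriv (μ + ν) z).toReal)
        - c * s z * √((μ.rnDeriv (μ + ν) z).toReal)) ^ 2 ∂(μ + ν) =
      ∫ z, (√((ν.rnDeriv μ z).toReal) - 1 - c * s z) ^ 2 ∂μ := by
  have hac : μ ≪ μ + ν := Measure.AbsolutelyContinuous.rfl.add_right ν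
  rw [← integral_rnDeriv_smul hac]
  refine integral_congr_ae ?_
  -- By the chain rule for densities, √(dμ/d(μ+ν)) factors out of all three terms; its square is the
  -- weight that changes μ + ν into μ.
  filter_upwards [Measure.rnDeriv_mul_rnDeriv (κ := μ + ν) hνμ] with z hz
  rw [← hz, Pi.mul_apply, ENNReal.toReal_mul, Real.sqrt_mul ENNReal.toReal_nonneg, smul_eq_mul]
  have hs : √((μ.rnDeriv (μ + ν) z).toReal) ^ 2 = _ := Real.sq_sqrt ENNReal.toReal_nonneg
  linear_combination (√((ν.rnDeriv μ z).toReal) - 1 - c * s z) ^ 2 * hs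

theorem norm_sq_rootDensity_sub {μ ν : Measure S} [IsProbabilityMeasure μ] [IsFiniteMeasure ν]
    (c : ℝ) (s : Lp ℝ 2 μ) :
    ‖rootDensity μ ν - rootDensity μ μ - c • s‖ ^ 2 =
      ∫ z, (√((ν.rnDeriv μ z).toReal) - 1 - c * s z) ^ 2 ∂μ := by
  rw [← real_inner_self_eq_norm_sq, L2.inner_def]
  refine integral_congr_ae ?_
  filter_upwards [Lp.coeFn_sub (rootDensity μ ν - rootDensity μ μ) (c • s),
    Lp.coeFn_sub (rootDensity μ ν) (rootDensity μ μ), Lp.coeFn_smul c s,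
    coeFn_rootDensity μ ν, coeFn_rootDensity μ μ, Measure.rnDeriv_self μ] with z h1 h2 h3 h4 h5 h6
  rw [h1, Pi.sub_apply, h2, Pi.sub_apply, h3, h4, h5, h6]
  simp [pow_two]

/-- Along a quadratic mean differentiable path, the root density is differentiable in `L²(P)`. -/
theorem IsQMDPath.hasDerivWithinAt_rootDensity {M : Set (ProbabilityMeasure S)}
    (hM : ∀ P₁ ∈ M, ∀ P₂ ∈ M, (P₁ : Measure S) ≪ (P₂ : Measure S))
    {P : ProbabilityMeasure S} (hP : P ∈ M) {s : Lp ℝ 2 (P : Measure S)}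
    {path : ℝ → ProbabilityMeasure S} (h : IsQMDPath M P s path) :
    HasDerivWithinAt (fun ε => rootDensity (P : Measure S) (path ε : Measure S))
      ((1 / 2 : ℝ) • s) (Set.Ioi 0) 0 := by
  obtain ⟨hmem, h0, ho⟩ := h
  rw [hasDerivWithinAt_iff_isLittleO]
  rw [← isLittleO_norm_left]
  refine IsLittleO.of_pow (n := 2) ?_ two_ne_zero
  have hev : ∀ᶠ ε : ℝ in 𝓝[>] 0, ε ∈ Set.Icc (0 : ℝ) 1 :=
    mem_of_superset (Ioo_mem_nhdsGT one_pos) Set.Ioo_subset_Icc_self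
  refine ho.congr' ?_ (Eventually.of_forall fun ε => by simp)
  filter_upwards [hev] with ε hε
  have hνμ := hM _ (hmem ε hε) _ hP
  rw [integral_qmd_eq hνμ, Pi.pow_apply, sub_zero, smul_smul, h0,
    ← norm_sq_rootDensity_sub, mul_one_div]

/-- The density of the product is the product of the densities, and the square root is
multiplicative on nonnegative reals. -/
theorem tensorL2_rootDensity (μ ν : Measure S) [IsProbabilityMeasure μ] [IsProbabilityMeasure ν]
    (hνμ : ν ≪ μ) :
    tensorL2 r μ (fun _ => rootDensity μ ν) = rootDensity (iidLaw r μ) (iidLaw r ν) := by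
  refine Lp.ext ?_
  filter_upwards [coeFn_tensorL2 (r := r) (fun _ : Fin r => rootDensity μ ν),
    coeFn_rootDensity (iidLaw r μ) (iidLaw r ν), rnDeriv_iidLaw (r := r) hνμ,
    ae_iidLaw_eval (r := r) (coeFn_rootDensity μ ν)] with z h1 h2 h3 h4
  rw [h1, h2, h3, ENNReal.toReal_prod, Real.sqrt_prod _ fun i _ => ENNReal.toReal_nonneg]
  exact Finset.prod_congr rfl fun i _ => h4 i

/-- The map `s ↦ ∑ᵢ s(zᵢ)` from `L²(μ)` to `L²(μ^r)`. -/
noncomputable def sumCoord (r : ℕ) (μ : Measure S) [IsProbabilityMeasure μ] :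
    Lp ℝ 2 μ →L[ℝ] Lp ℝ 2 (iidLaw r μ) :=
  ∑ i : Fin r, (Lp.compMeasurePreservingₗᵢ ℝ (fun z : Fin r → S => z i)
    (measurePreserving_eval (fun _ : Fin r => μ) i)).toContinuousLinearMap

theorem coeFn_sumCoord (μ : Measure S) [IsProbabilityMeasure μ] (s : Lp ℝ 2 μ) :
    sumCoord r μ s =ᵐ[iidLaw r μ] fun z => ∑ i, s (z i) := by
  rw [sumCoord, sum_apply]
  refine (Lp.coeFn_finsetSum _ _).trans ?_
  have h : ∀ᵐ z ∂(iidLaw r μ), ∀ i : Fin r, (Lp.compMeasurePreservingₗᵢ ℝ (fun z : Fin r → S => z i)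
      (measurePreserving_eval (fun _ : Fin r => μ) i)).toContinuousLinearMap s z = s (z i) :=
    ae_all_iff.2 fun i => Lp.coeFn_compMeasurePreserving s (measurePreserving_eval (fun _ => μ) i)
  filter_upwards [h] with z hz
  rw [Finset.sum_apply]
  exact Finset.sum_congr rfl fun i _ => hz i

/-- Chain rule for a continuous multilinear map on the diagonal. At ε = 0 every root density is 1,
so changing the i-th argument to h leaves h(zᵢ). -/
theorem hasDerivWithinAt_rootDensity_iidLaw {μ : Measure S} [IsProbabilityMeasure μ]
    {ν : ℝ → Measure S} [∀ ε, IsProbabilityMeasure (ν ε)] (h0 : ν 0 = μ) {h : Lp ℝ 2 μ}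
    (hd : HasDerivWithinAt (fun ε => rootDensity μ (ν ε)) h (Set.Ioi 0) 0) :
    HasDerivWithinAt (fun ε => tensorL2 r μ fun _ => rootDensity μ (ν ε))
      (sumCoord r μ h) (Set.Ioi 0) 0 := by
  have hpi : HasDerivWithinAt (fun ε => fun _ : Fin r => rootDensity μ (ν ε))
      (fun _ => h) (Set.Ioi 0) 0 := hasDerivWithinAt_pi.2 fun _ => hd
  have hT := ((tensorL2 r μ).hasFDerivAt (fun _ => rootDensity μ (ν 0))).comp_hasDerivWithinAt 0 hpi
  convert! hT using 1
  have h00 : rootDensity μ (ν 0) = rootDensity μ μ := by simp only [h0]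
  rw [ContinuousMultilinearMap.linearDeriv_apply, h00]
  refine Lp.ext ?_
  refine (coeFn_sumCoord μ h).trans (EventuallyEq.trans ?_ (Lp.coeFn_finsetSum _ _).symm)
  have hT : ∀ᵐ z ∂(iidLaw r μ), ∀ i : Fin r,
      tensorL2 r μ (Function.update (fun _ => rootDensity μ μ) i h) z = h (z i) := by
    refine ae_all_iff.2 fun i => ?_
    filter_upwards [coeFn_tensorL2 (Function.update (fun _ : Fin r => rootDensity μ μ) i h),
      ae_iidLaw_eval (r := r) (coeFn_rootDensity μ μ),
      ae_iidLaw_eval (r := r) (Measure.rnDeriv_self μ)] with z h1 h2 h3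
    rw [h1, prod_update_coeFn, Finset.prod_eq_one fun j _ => by rw [h2, h3]; simp, mul_one]
  filter_upwards [hT] with z hz
  rw [Finset.sum_apply]
  exact Finset.sum_congr rfl fun i _ => (hz i).symm

/-- The product root densities along a quadratic mean differentiable path have score
`∑ᵢ s(zᵢ)`. -/
theorem IsQMDPath.tendsto_sqrt_rnDeriv_iidLaw {M : Set (ProbabilityMeasure S)}
    (hM : ∀ P₁ ∈ M, ∀ P₂ ∈ M, (P₁ : Measure S) ≪ (P₂ : Measure S))
    {P : ProbabilityMeasure S} (hP : P ∈ M) {s : Lp ℝ 2 (P : Measure S)}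
    {path : ℝ → ProbabilityMeasure S} (h : IsQMDPath M P s path) (r : ℕ) {ε : ℕ → ℝ}
    (hε : Tendsto ε atTop (𝓝[>] 0)) (hmem : ∀ n, path (ε n) ∈ M) :
    Tendsto (fun n => eLpNorm (fun z => (ε n)⁻¹ *
      (√((iidLaw r (path (ε n) : Measure S)).rnDeriv (iidLaw r (P : Measure S)) z).toReal - 1)
        - 1 / 2 * sumCoord r (P : Measure S) s z) 2 (iidLaw r (P : Measure S))) atTop (𝓝 0) := by
  have hd := hasDerivWithinAt_rootDensity_iidLaw (r := r) (μ := (P : Measure S))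
    (ν := fun ε => (path ε : Measure S)) (by rw [h.2.1]) (h.hasDerivWithinAt_rootDensity hM hP)
  rw [hasDerivWithinAt_iff_tendsto_slope' (Set.self_notMem_Ioi)] at hd
  have hlim := (tendsto_iff_norm_sub_tendsto_zero.1 (hd.comp hε))
  have hlim2 := ENNReal.tendsto_ofReal hlim
  rw [ENNReal.ofReal_zero] at hlim2
  refine hlim2.congr fun n => ?_
  rw [ofReal_norm, Lp.enorm_def]
  refine eLpNorm_congr_ae ?_
  have h00 : rootDensity (P : Measure S) (path 0 : Measure S) = rootDensity (P : Measure S) P := by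
    simp only [h.2.1]
  simp only [Function.comp_apply, slope_def_module, sub_zero, h00, map_smul]
  rw [tensorL2_rootDensity _ _ (hM _ (hmem n) _ hP), tensorL2_rootDensity _ _ (hM _ hP _ hP)]
  set A := rootDensity (iidLaw r (P : Measure S)) (iidLaw r (path (ε n) : Measure S))
  set B := rootDensity (iidLaw r (P : Measure S)) (iidLaw r (P : Measure S))
  filter_upwards [Lp.coeFn_sub ((ε n)⁻¹ • (A - B)) ((1 / 2 : ℝ) • sumCoord r (P : Measure S) s),
    Lp.coeFn_smul (ε n)⁻¹ (A - B), Lp.coeFn_sub A B,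
    Lp.coeFn_smul (1 / 2 : ℝ) (sumCoord r (P : Measure S) s),
    coeFn_rootDensity (iidLaw r (P : Measure S)) (iidLaw r (path (ε n) : Measure S)),
    coeFn_rootDensity (iidLaw r (P : Measure S)) (iidLaw r (P : Measure S)),
    Measure.rnDeriv_self (iidLaw r (P : Measure S))] with z h1 h2 h3 h4 h5 h6 h7
  rw [h1, Pi.sub_apply, h2, Pi.smul_apply, h3, Pi.sub_apply, h4, Pi.smul_apply, h5, h6, h7]
  simp

end RootDensity

/-! ### The conditional mean as an operator between L² spaces, and its duality formula. -/

section CondMeanOperator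

variable {Ω S : Type*} [MeasurableSpace Ω] [mS : MeasurableSpace S] {μ : Measure Ω} {X : Ω → S}
  {ν κ : Measure S}

theorem condMean_apply (μ : Measure Ω) (X : Ω → S) (f : Ω → ℝ) (ω : Ω) :
    condMean μ X f (X ω) = (μ[f | mS.comap X]) ω :=
  (congrFun (condMean_spec μ X f).2 ω).symm

theorem measurable_condMean (μ : Measure Ω) (X : Ω → S) (f : Ω → ℝ) :
    Measurable (condMean μ X f) :=
  (condMean_spec μ X f).1.measurable

theorem condMean_ae_eq (hX : Measurable X) (hν : μ.map X = ν) {f : Ω → ℝ} {g : S → ℝ}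
    (hg : Measurable g) (h : μ[f | mS.comap X] =ᵐ[μ] fun ω => g (X ω)) :
    condMean μ X f =ᵐ[ν] g := by
  rw [← hν]
  refine (ae_map_iff hX.aemeasurable (measurableSet_eq_fun (measurable_condMean μ X f) hg)).2 ?_
  filter_upwards [h] with ω hω
  rw [condMean_apply, hω]

theorem condMean_congr_ae (hX : Measurable X) (hν : μ.map X = ν) {f g : Ω → ℝ} (h : f =ᵐ[μ] g) :
    condMean μ X f =ᵐ[ν] condMean μ X g := by
  refine condMean_ae_eq hX hν (measurable_condMean μ X g) ?_
  simp_rw [condMean_apply]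
  exact condExp_congr_ae h

theorem eLpNorm_condMean (hX : Measurable X) (hν : μ.map X = ν) (f : Ω → ℝ) :
    eLpNorm (condMean μ X f) 2 ν = eLpNorm (μ[f | mS.comap X]) 2 μ := by
  rw [← hν, eLpNorm_map_measure (measurable_condMean μ X f).aestronglyMeasurable hX.aemeasurable,
    (condMean_spec μ X f).2]

theorem memLp_condMean (hX : Measurable X) (hν : μ.map X = ν) {f : Ω → ℝ}
    (h : MemLp (μ[f | mS.comap X]) 2 μ) : MemLp (condMean μ X f) 2 ν :=
  ⟨(measurable_condMean μ X f).aestronglyMeasurable, by rw [eLpNorm_condMean hX hν]; exact h.2⟩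

/-- Multiplication by a factor with bounded conditional second moment, followed by the conditional
mean, is a continuous linear operator between `L²` spaces. -/
theorem exists_condMeanL2 [IsFiniteMeasure μ] (hX : Measurable X) (hν : μ.map X = ν) {c : ℝ≥0∞}
    (hc : c ≠ ∞) (hκ : κ ≤ c • ν) {f : Ω → ℝ} (hf : MemLp f 2 μ) {d : ℝ} (hd : 0 < d)
    (hfd : ∀ᵐ ω ∂μ, (μ[fun ω => f ω ^ 2 | mS.comap X]) ω ≤ d) :
    ∃ K : Lp ℝ 2 μ →L[ℝ] Lp ℝ 2 κ,
      ∀ b : Lp ℝ 2 μ, K b =ᵐ[κ] condMean μ X fun ω => b ω * f ω := by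
  have hac : κ ≪ ν := Measure.absolutelyContinuous_of_le_smul hκ
  have hm := hX.comap_le
  have hL : ∀ b : Lp ℝ 2 μ, MemLp (condMean μ X fun ω => b ω * f ω) 2 κ := fun b =>
    (memLp_condMean hX hν (memLp_condExp_mul hm (Lp.memLp b) hf hd hfd)).of_measure_le_smul hc hκ
  have hbf : ∀ b : Lp ℝ 2 μ, Integrable (fun ω => b ω * f ω) μ := fun b =>
    (Lp.memLp b).integrable_mul hf
  -- In the operator bound, c^(1/2) comes from passing from ν to κ and √d from conditional
  -- Cauchy–Schwarz.
  refine ⟨LinearMap.mkContinuous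
    { toFun := fun b => (hL b).toLp _
      map_add' := fun x y => ?_
      map_smul' := fun a x => ?_ } (c ^ (1 / (2 : ℝ≥0∞)).toReal * ENNReal.ofReal √d).toReal
      fun b => ?_, fun b => (hL b).coeFn_toLp⟩
  · rw [← MemLp.toLp_add, MemLp.toLp_eq_toLp_iff]
    refine hac.ae_eq (condMean_ae_eq hX hν ((measurable_condMean ..).add (measurable_condMean ..)) ?_)
    simp only [Pi.add_apply, condMean_apply]
    refine EventuallyEq.trans ?_ (condExp_add (hbf x) (hbf y) _)
    refine condExp_congr_ae ?_
    filter_upwards [Lp.coeFn_add x y] with ω hω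
    rw [hω, Pi.add_apply, Pi.add_apply, add_mul]
  · rw [RingHom.id_apply, ← MemLp.toLp_const_smul, MemLp.toLp_eq_toLp_iff]
    refine hac.ae_eq (condMean_ae_eq hX hν ((measurable_condMean ..).const_smul a) ?_)
    simp only [Pi.smul_apply, condMean_apply]
    refine EventuallyEq.trans ?_ (condExp_smul a (fun ω => x ω * f ω) _)
    refine condExp_congr_ae ?_
    filter_upwards [Lp.coeFn_smul a x] with ω hω
    rw [hω, Pi.smul_apply, Pi.smul_apply, smul_mul_assoc]
  · simp only [LinearMap.coe_mk, AddHom.coe_mk, Lp.norm_toLp]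
    rw [Lp.norm_def, ← ENNReal.toReal_mul]
    refine ENNReal.toReal_mono (ENNReal.mul_ne_top (ENNReal.mul_ne_top
      (ENNReal.rpow_ne_top_of_nonneg (by simp) hc) ENNReal.ofReal_ne_top) (Lp.eLpNorm_ne_top b)) ?_
    refine (eLpNorm_le_of_measure_le_smul hκ).trans ?_
    rw [mul_assoc, eLpNorm_condMean hX hν]
    exact mul_le_mul' le_rfl (eLpNorm_condExp_mul_le hm (Lp.memLp b) hf hd hfd)

theorem rnDeriv_le_of_le_smul [IsFiniteMeasure ν] [IsFiniteMeasure κ] {c : ℝ≥0∞}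
    (hκ : κ ≤ c • ν) : ∀ᵐ x ∂ν, κ.rnDeriv ν x ≤ c := by
  refine ae_le_of_forall_setLIntegral_le_of_sigmaFinite (Measure.measurable_rnDeriv κ ν)
    fun s hs _ => ?_
  rw [setLIntegral_const]
  exact (Measure.setLIntegral_rnDeriv_le s).trans (hκ s)

/-- The image under X of the measure with density f² is at most d times the law of X, because the
conditional second moment of f is at most d; then integrate G. -/
theorem lintegral_sq_mul_comp_le [IsFiniteMeasure μ] (hX : Measurable X) {f : Ω → ℝ}
    (hf : MemLp f 2 μ) {d : ℝ} (hd : 0 < d)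
    (hfd : ∀ᵐ ω ∂μ, (μ[fun ω => f ω ^ 2 | mS.comap X]) ω ≤ d) {G : S → ℝ≥0∞}
    (hG : Measurable G) :
    ∫⁻ ω, ENNReal.ofReal (f ω ^ 2) * G (X ω) ∂μ ≤ ENNReal.ofReal d * ∫⁻ x, G x ∂(μ.map X) := by
  have hf2 : AEMeasurable (fun ω => ENNReal.ofReal (f ω ^ 2)) μ :=
    (hf.1.aemeasurable.pow_const 2).ennreal_ofReal
  have hle : (μ.withDensity fun ω => ENNReal.ofReal (f ω ^ 2)).map X ≤
      ENNReal.ofReal d • μ.map X := by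
    refine Measure.le_iff.2 fun s hs => ?_
    have hXs : MeasurableSet[mS.comap X] (X ⁻¹' s) := ⟨s, hs, rfl⟩
    rw [Measure.map_apply hX hs, withDensity_apply _ (hX hs), Measure.smul_apply,
      Measure.map_apply hX hs, smul_eq_mul, ← ofReal_integral_eq_lintegral_ofReal
      hf.integrable_sq.integrableOn (Eventually.of_forall fun ω => sq_nonneg _),
      ← setIntegral_condExp hX.comap_le hf.integrable_sq hXs]
    have h1 : ∫ ω in X ⁻¹' s, (μ[fun ω => f ω ^ 2 | mS.comap X]) ω ∂μ ≤
        ∫ _ in X ⁻¹' s, d ∂μ :=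
      setIntegral_mono_ae integrable_condExp.integrableOn (integrable_const d) hfd
    refine (ENNReal.ofReal_le_ofReal h1).trans (le_of_eq ?_)
    rw [setIntegral_const, smul_eq_mul, mul_comm, ENNReal.ofReal_mul hd.le,
      ofReal_measureReal]
  calc ∫⁻ ω, ENNReal.ofReal (f ω ^ 2) * G (X ω) ∂μ
      = ∫⁻ x, G x ∂((μ.withDensity fun ω => ENNReal.ofReal (f ω ^ 2)).map X) := by
        rw [lintegral_map hG hX, lintegral_withDensity_eq_lintegral_mul₀ hf2
          (g := fun ω => G (X ω)) (hG.comp hX).aemeasurable]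
        rfl
    _ ≤ ∫⁻ x, G x ∂(ENNReal.ofReal d • μ.map X) := lintegral_mono' hle le_rfl
    _ = ENNReal.ofReal d * ∫⁻ x, G x ∂(μ.map X) := by rw [lintegral_smul_measure, smul_eq_mul]

/-- The density ρ = dκ/dν is at most c, so ρ² ≤ cρ. One factor ρ is spent on returning to κ, where w
is square integrable. The function is the representer in the duality formula. -/
theorem memLp_rnDeriv_mul_mul_comp [IsFiniteMeasure μ] [IsFiniteMeasure κ] (hX : Measurable X)
    (hν : μ.map X = ν) {c : ℝ≥0∞} (hc : c ≠ ∞) (hκ : κ ≤ c • ν) {f : Ω → ℝ} (hf : MemLp f 2 μ)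
    {d : ℝ} (hd : 0 < d) (hfd : ∀ᵐ ω ∂μ, (μ[fun ω => f ω ^ 2 | mS.comap X]) ω ≤ d)
    (w : Lp ℝ 2 κ) :
    MemLp (fun ω => (κ.rnDeriv ν (X ω)).toReal * f ω * w (X ω)) 2 μ := by
  have : IsFiniteMeasure ν := by rw [← hν]; infer_instance
  have hac : κ ≪ ν := Measure.absolutelyContinuous_of_le_smul hκ
  have hwm : Measurable w := (Lp.stronglyMeasurable w).measurable
  have hρm : Measurable fun x => (κ.rnDeriv ν x).toReal := by fun_prop
  have hmeas : AEStronglyMeasurable (fun ω => (κ.rnDeriv ν (X ω)).toReal * f ω * w (X ω)) μ :=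
    ((hρm.comp hX).aestronglyMeasurable.mul hf.1).mul (hwm.comp hX).aestronglyMeasurable
  refine ⟨hmeas, ?_⟩
  rw [eLpNorm_two_eq_lintegral_sq]
  refine ENNReal.rpow_lt_top_of_nonneg (by norm_num) (ne_of_lt ?_)
  have hw2 : ∫⁻ x, ENNReal.ofReal (w x ^ 2) ∂κ < ∞ := by
    rw [← ofReal_integral_eq_lintegral_ofReal (Lp.memLp w).integrable_sq
      (Eventually.of_forall fun ω => sq_nonneg _)]
    exact ENNReal.ofReal_lt_top
  calc ∫⁻ ω, ENNReal.ofReal (((κ.rnDeriv ν (X ω)).toReal * f ω * w (X ω)) ^ 2) ∂μ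
      = ∫⁻ ω, ENNReal.ofReal (f ω ^ 2) *
          ENNReal.ofReal ((κ.rnDeriv ν (X ω)).toReal ^ 2 * w (X ω) ^ 2) ∂μ := by
        refine lintegral_congr fun ω => ?_
        rw [← ENNReal.ofReal_mul (sq_nonneg _)]
        congr 1
        ring
    _ ≤ ENNReal.ofReal d * ∫⁻ x, ENNReal.ofReal ((κ.rnDeriv ν x).toReal ^ 2 * w x ^ 2) ∂ν := by
        rw [← hν]
        exact lintegral_sq_mul_comp_le hX hf hd hfd
          (G := fun x => ENNReal.ofReal ((κ.rnDeriv (μ.map X) x).toReal ^ 2 * w x ^ 2))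
          (by fun_prop)
    _ ≤ ENNReal.ofReal d * ∫⁻ x, c * (κ.rnDeriv ν x * ENNReal.ofReal (w x ^ 2)) ∂ν := by
        gcongr ENNReal.ofReal d * ?_
        refine lintegral_mono_ae ?_
        filter_upwards [rnDeriv_le_of_le_smul hκ] with x hx
        rw [ENNReal.ofReal_mul (sq_nonneg _), ENNReal.ofReal_pow ENNReal.toReal_nonneg,
          ENNReal.ofReal_toReal (hx.trans_lt hc.lt_top).ne, pow_two, mul_assoc]
        gcongr
    _ = ENNReal.ofReal d * (c * ∫⁻ x, ENNReal.ofReal (w x ^ 2) ∂κ) := by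
        rw [lintegral_const_mul _ (by fun_prop), lintegral_rnDeriv_mul hac (by fun_prop)]
    _ < ∞ := ENNReal.mul_lt_top ENNReal.ofReal_lt_top (ENNReal.mul_lt_top hc.lt_top hw2)

/-- The adjoint relation for the operator of `exists_condMeanL2`. -/
theorem inner_condMean_mul [IsFiniteMeasure μ] [IsFiniteMeasure κ] (hX : Measurable X)
    (hν : μ.map X = ν) {c : ℝ≥0∞} (hc : c ≠ ∞) (hκ : κ ≤ c • ν) {f : Ω → ℝ} (hf : MemLp f 2 μ)
    {d : ℝ} (hd : 0 < d) (hfd : ∀ᵐ ω ∂μ, (μ[fun ω => f ω ^ 2 | mS.comap X]) ω ≤ d)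
    (b : Lp ℝ 2 μ) (w k : Lp ℝ 2 κ) (hk : k =ᵐ[κ] condMean μ X fun ω => b ω * f ω) :
    inner ℝ k w = ∫ ω, b ω * ((κ.rnDeriv ν (X ω)).toReal * f ω * w (X ω)) ∂μ := by
  have : IsFiniteMeasure ν := by rw [← hν]; infer_instance
  have hac : κ ≪ ν := Measure.absolutelyContinuous_of_le_smul hκ
  have hwm : Measurable w := (Lp.stronglyMeasurable w).measurable
  have hρm : Measurable fun x => (κ.rnDeriv ν x).toReal := by fun_prop
  set g : S → ℝ := fun x => (κ.rnDeriv ν x).toReal * w x with hg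
  have hgm : StronglyMeasurable[mS.comap X] fun ω => g (X ω) :=
    (hρm.mul hwm).stronglyMeasurable.comp_measurable (comap_measurable X)
  have hbG := (Lp.memLp b).integrable_mul (memLp_rnDeriv_mul_mul_comp hX hν hc hκ hf hd hfd w)
  have e : (fun ω => b ω * f ω) * (fun ω => g (X ω)) =
      fun ω => b ω * ((κ.rnDeriv ν (X ω)).toReal * f ω * w (X ω)) := by
    ext ω
    simp only [Pi.mul_apply, hg]
    ring
  have hpull := condExp_mul_of_stronglyMeasurable_right (μ := μ) hgm
    (f := fun ω => b ω * f ω) (by rw [e]; exact hbG) ((Lp.memLp b).integrable_mul hf)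
  rw [← integral_condExp hX.comap_le, ← e, integral_congr_ae hpull, L2.inner_def]
  calc ∫ x, inner ℝ (k x) (w x) ∂κ
      = ∫ x, condMean μ X (fun ω => b ω * f ω) x * w x ∂κ := by
        refine integral_congr_ae ?_
        filter_upwards [hk] with x hx
        rw [hx]
        simp [mul_comm]
    _ = ∫ x, condMean μ X (fun ω => b ω * f ω) x * g x ∂ν := by
        rw [← integral_rnDeriv_smul hac]
        refine integral_congr_ae (Eventually.of_forall fun x => ?_)
        simp only [hg, smul_eq_mul]
        ring
    _ = ∫ ω, condMean μ X (fun ω => b ω * f ω) (X ω) * g (X ω) ∂μ := by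
        rw [← hν, integral_map hX.aemeasurable]
        rw [hν]
        exact ((measurable_condMean ..).mul (hρm.mul hwm)).aestronglyMeasurable
    _ = _ := by simp only [condMean_apply, Pi.mul_apply]

end CondMeanOperator

/-! ### The dominated class: its tangent space, and differentiability of θ in the measure. -/

section DominatedClass

variable {Z X : Type*} [MeasurableSpace Z] [MeasurableSpace X] {C : Z → X} {r : ℕ}
  {M : Set (ProbabilityMeasure Z)} {ustar : (Fin r → Z) → ℝ} {Q P : ProbabilityMeasure Z}

/-- Any direction is tangent to the class of functions dominated by a positive function. -/
theorem hilbertTangentSpace_dominatedClass_eq_top (hustar : Measurable ustar)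
    (hpos : ∀ z, 0 < ustar z) {u : Lp ℝ 2 (iidLaw r (Q : Measure Z))} (hu : u ∈ dominatedClass r Q ustar) :
    hilbertTangentSpace (dominatedClass r Q ustar) u = ⊤ := by
  set V := hilbertTangentSpace (dominatedClass r Q ustar) u
  -- The class is convex, so the segment from u to v is a path with exact direction v − u.
  have hsub : ∀ v ∈ dominatedClass r Q ustar, v - u ∈ V := by
    intro v hv
    refine Submodule.le_topologicalClosure _ (Submodule.subset_span
      ⟨fun ε => u + ε • (v - u), fun ε hε => ?_, ?_⟩)
    · filter_upwards [hu, hv, Lp.coeFn_add u (ε • (v - u)), Lp.coeFn_smul ε (v - u),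
        Lp.coeFn_sub v u] with z h1 h2 h3 h4 h5
      rw [h3, Pi.add_apply, h4, Pi.smul_apply, h5, Pi.sub_apply, smul_eq_mul]
      have e : u z + ε * (v z - u z) = (1 - ε) * u z + ε * v z := by ring
      rw [e, abs_le]
      obtain ⟨h1l, h1r⟩ := abs_le.1 h1
      obtain ⟨h2l, h2r⟩ := abs_le.1 h2
      have hε0 := hε.1
      have hε1 : 0 ≤ 1 - ε := sub_nonneg.2 hε.2
      constructor <;> nlinarith
    · simp only [add_sub_cancel_left, sub_self]
      exact isLittleO_zero _ _
  have h0 : (0 : Lp ℝ 2 (iidLaw r (Q : Measure Z))) ∈ dominatedClass r Q ustar := by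
    filter_upwards [Lp.coeFn_zero ℝ 2 (iidLaw r (Q : Measure Z))] with z hz
    rw [hz]
    simpa using (hpos z).le
  have hmem : ∀ v ∈ dominatedClass r Q ustar, v ∈ V := fun v hv => by
    simpa using V.sub_mem (hsub v hv) (hsub 0 h0)
  refine eq_top_iff.2 fun t _ => ?_
  have htm : Measurable t := (Lp.stronglyMeasurable t).measurable
  -- Truncate t where |t| exceeds n times `ustar`. Positivity of `ustar` makes these sets exhaust
  -- the space, so the truncations are dense.
  set A : ℕ → Set (Fin r → Z) := fun n => {z | |t z| ≤ n * ustar z} with hA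
  have hAm : ∀ n, MeasurableSet (A n) := fun n => measurableSet_le (by fun_prop) (by fun_prop)
  have hTL : ∀ n, MemLp ((A n).indicator t) 2 (iidLaw r (Q : Measure Z)) := fun n =>
    (Lp.memLp t).indicator (hAm n)
  have hTV : ∀ n, (hTL n).toLp _ ∈ V := by
    intro n
    -- Rescaling by n + 1 instead of n avoids division by zero at n = 0.
    have hbd : ((n + 1 : ℝ)⁻¹) • (hTL n).toLp _ ∈ dominatedClass r Q ustar := by
      filter_upwards [Lp.coeFn_smul ((n + 1 : ℝ)⁻¹) ((hTL n).toLp _), (hTL n).coeFn_toLp]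
        with z h1 h2
      rw [h1, Pi.smul_apply, h2, smul_eq_mul, abs_mul, abs_of_pos (by positivity),
        inv_mul_le_iff₀ (by positivity)]
      by_cases hz : z ∈ A n
      · rw [Set.indicator_of_mem hz]
        have h3 : |t z| ≤ n * ustar z := hz
        linarith [hpos z]
      · rw [Set.indicator_of_notMem hz, abs_zero]
        have := hpos z
        positivity
    have := V.smul_mem (n + 1 : ℝ) (hmem _ hbd)
    rwa [smul_smul, mul_inv_cancel₀ (by positivity), one_smul] at this
  have hlim : Tendsto (fun n => eLpNorm (fun z => t z * (-(A n)ᶜ.indicator 1 z)) 2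
      (iidLaw r (Q : Measure Z))) atTop (𝓝 0) := by
    refine tendsto_eLpNorm_two_mul_zero (Lp.memLp t) (fun n => ?_) (fun n z => ?_)
      (Eventually.of_forall fun z => ?_)
    · exact ((measurable_one.indicator (hAm n).compl).neg).aestronglyMeasurable
    · by_cases hz : z ∈ (A n)ᶜ <;> simp [Set.indicator, hz]
    · obtain ⟨N, hN⟩ := exists_nat_ge (|t z| / ustar z)
      refine tendsto_const_nhds.congr' ?_
      filter_upwards [eventually_ge_atTop N] with n hn
      have : z ∈ A n := by
        change |t z| ≤ n * ustar z
        rw [← div_le_iff₀ (hpos z)]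
        exact hN.trans (by exact_mod_cast hn)
      simp [this]
  refine (Submodule.isClosed_topologicalClosure _).mem_of_tendsto (f := fun n => (hTL n).toLp _)
    (b := atTop) ?_ (Eventually.of_forall hTV)
  rw [tendsto_iff_norm_sub_tendsto_zero]
  have hlim2 := (ENNReal.tendsto_toReal ENNReal.zero_ne_top).comp hlim
  refine hlim2.congr fun n => ?_
  rw [Function.comp_apply, Lp.norm_def]
  congr 1
  refine eLpNorm_congr_ae ?_
  filter_upwards [Lp.coeFn_sub ((hTL n).toLp _) t, (hTL n).coeFn_toLp] with z h1 h2
  rw [h1, Pi.sub_apply, h2]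
  by_cases hz : z ∈ A n <;> simp [hz]

theorem abs_condExp_le_of_mem_dominatedClass (hC : Measurable C)
    (hM : ∀ P₁ ∈ M, ∀ P₂ ∈ M, (P₁ : Measure Z) ≪ (P₂ : Measure Z)) {K : ℝ} (hK : 0 < K)
    (hbd : ∀ P' ∈ M, Integrable (fun z => ustar z ^ 2) (iidLaw r (P' : Measure Z)) ∧
      ∀ᵐ z ∂(iidLaw r (P' : Measure Z)), ((iidLaw r (P' : Measure Z))[fun z => ustar z ^ 2 |
        MeasurableSpace.pi.comap (coarsen C r)]) z ≤ K ^ 2)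
    (hQ : Q ∈ M) (hP : P ∈ M) {v : Lp ℝ 2 (iidLaw r (Q : Measure Z))}
    (hv : v ∈ dominatedClass r Q ustar) :
    ∀ᵐ z ∂(iidLaw r (P : Measure Z)),
      |((iidLaw r (P : Measure Z))[v | MeasurableSpace.pi.comap (coarsen C r)]) z| ≤ K :=
  abs_condExp_le_of_condExp_sq_le (measurable_coarsen hC).comap_le (hbd P hP).1
    (iidLaw_absolutelyContinuous (hM P hP Q hQ) hv) hK (hbd P hP).2

theorem memLp_of_mem_dominatedClass
    (hM : ∀ P₁ ∈ M, ∀ P₂ ∈ M, (P₁ : Measure Z) ≪ (P₂ : Measure Z))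
    (hint : Integrable (fun z => ustar z ^ 2) (iidLaw r (P : Measure Z)))
    (hQ : Q ∈ M) (hP : P ∈ M) {v : Lp ℝ 2 (iidLaw r (Q : Measure Z))}
    (hv : v ∈ dominatedClass r Q ustar) : MemLp v 2 (iidLaw r (P : Measure Z)) :=
  memLp_two_of_abs_le (Lp.stronglyMeasurable v).aestronglyMeasurable hint
    (iidLaw_absolutelyContinuous (hM P hP Q hQ) hv)

/-- The conditional mean is bounded by K almost surely under P^r, hence under Q^r by absolute
continuity, and bounded functions are square integrable under a probability law. -/
theorem memLp_multifoldMean (hC : Measurable C)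
    (hM : ∀ P₁ ∈ M, ∀ P₂ ∈ M, (P₁ : Measure Z) ≪ (P₂ : Measure Z)) {K : ℝ} (hK : 0 < K)
    (hbd : ∀ P' ∈ M, Integrable (fun z => ustar z ^ 2) (iidLaw r (P' : Measure Z)) ∧
      ∀ᵐ z ∂(iidLaw r (P' : Measure Z)), ((iidLaw r (P' : Measure Z))[fun z => ustar z ^ 2 |
        MeasurableSpace.pi.comap (coarsen C r)]) z ≤ K ^ 2)
    (hQ : Q ∈ M) (hP : P ∈ M) {v : Lp ℝ 2 (iidLaw r (Q : Measure Z))}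
    (hv : v ∈ dominatedClass r Q ustar) :
    MemLp (multifoldMean C r P v) 2 (iidLaw r ((Q : Measure Z).map C)) := by
  have : IsProbabilityMeasure ((Q : Measure Z).map C) :=
    Measure.isProbabilityMeasure_map hC.aemeasurable
  refine MemLp.of_bound (measurable_condMean ..).aestronglyMeasurable K ?_
  rw [← map_coarsen_iidLaw hC]
  refine (ae_map_iff (measurable_coarsen hC).aemeasurable
    (measurableSet_le (measurable_condMean ..).norm measurable_const)).2 ?_
  filter_upwards [iidLaw_absolutelyContinuous (hM Q hQ P hP)
    (abs_condExp_le_of_mem_dominatedClass hC hM hK hbd hQ hP hv)] with z hz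
  rwa [Real.norm_eq_abs, condMean_apply]

theorem coeFn_multifoldMeanL2 {v : Lp ℝ 2 (iidLaw r (Q : Measure Z))}
    (h : MemLp (multifoldMean C r P v) 2 (iidLaw r ((Q : Measure Z).map C))) :
    multifoldMeanL2 C r Q P v =ᵐ[iidLaw r ((Q : Measure Z).map C)] multifoldMean C r P v := by
  rw [multifoldMeanL2, dif_pos h]
  exact h.coeFn_toLp

theorem IsHilbertPath.tendsto {T : Type*} [NormedAddCommGroup T] [InnerProductSpace ℝ T]
    {U : Set T} {u t : T} {path : ℝ → T} (h : IsHilbertPath U u t path) :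
    Tendsto path (𝓝[>] 0) (𝓝 u) := by
  have hid : Tendsto (fun ε : ℝ => ε) (𝓝[>] 0) (𝓝 0) := tendsto_nhdsWithin_of_tendsto_nhds tendsto_id
  have h1 := (h.2.isBigO.trans_tendsto hid).add ((hid.smul_const t).add_const u)
  simp only [zero_smul, zero_add] at h1
  refine h1.congr fun ε => ?_
  abel

/-- Differentiability of the multifold conditional mean in the model, uniformly enough to move the
second argument along a path. -/
theorem isLittleO_multifoldMeanL2_model (hC : Measurable C)
    (hM : ∀ P₁ ∈ M, ∀ P₂ ∈ M, (P₁ : Measure Z) ≪ (P₂ : Measure Z)) {K : ℝ} (hK : 0 < K)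
    (hbd : ∀ P' ∈ M, Integrable (fun z => ustar z ^ 2) (iidLaw r (P' : Measure Z)) ∧
      ∀ᵐ z ∂(iidLaw r (P' : Measure Z)), ((iidLaw r (P' : Measure Z))[fun z => ustar z ^ 2 |
        MeasurableSpace.pi.comap (coarsen C r)]) z ≤ K ^ 2)
    (hQ : Q ∈ M) (hP : P ∈ M) {c c' : ℝ≥0∞} (hc : c ≠ ∞)
    (hκ : iidLaw r ((Q : Measure Z).map C) ≤ c • iidLaw r ((P : Measure Z).map C))
    (hc' : c' ≠ ∞) (hPQ : iidLaw r (P : Measure Z) ≤ c' • iidLaw r (Q : Measure Z))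
    {u t : Lp ℝ 2 (iidLaw r (Q : Measure Z))} (hu : u ∈ dominatedClass r Q ustar)
    {s : Lp ℝ 2 (P : Measure Z)} {Ppath : ℝ → ProbabilityMeasure Z}
    {upath : ℝ → Lp ℝ 2 (iidLaw r (Q : Measure Z))} (hPpath : IsQMDPath M P s Ppath)
    (hupath : IsHilbertPath (dominatedClass r Q ustar) u t upath)
    {D : Lp ℝ 2 (iidLaw r (P : Measure Z)) →L[ℝ] Lp ℝ 2 (iidLaw r ((Q : Measure Z).map C))}
    (hD : ∀ b, D b =ᵐ[iidLaw r ((Q : Measure Z).map C)]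
      condMean (iidLaw r (P : Measure Z)) (coarsen C r) fun z =>
        b z * (u z - multifoldMean C r P u (coarsen C r z))) :
    (fun ε => multifoldMeanL2 C r Q (Ppath ε) (upath ε) - multifoldMeanL2 C r Q P (upath ε)
      - ε • D (sumCoord r (P : Measure Z) s)) =o[𝓝[>] 0] fun ε : ℝ => ε := by
  have hX := measurable_coarsen (r := r) hC
  have hne : ∀ᶠ ε : ℝ in 𝓝[>] 0, ε = 0 → ‖multifoldMeanL2 C r Q (Ppath ε) (upath ε) -
      multifoldMeanL2 C r Q P (upath ε) - ε • D (sumCoord r (P : Measure Z) s)‖ = 0 := by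
    filter_upwards [self_mem_nhdsWithin] with ε hε h0
    exact absurd h0 (ne_of_gt hε)
  rw [← isLittleO_norm_left, isLittleO_iff_tendsto' hne]
  refine tendsto_of_seq_tendsto fun ε' hε' => ?_
  have hev : ∀ᶠ n in atTop, ε' n ∈ Set.Ioo (0 : ℝ) 1 := hε' (Ioo_mem_nhdsGT one_pos)
  obtain ⟨N, hN⟩ := eventually_atTop.1 hev
  -- Drop finitely many terms so that the whole sequence lies in (0, 1), where the paths stay in the
  -- model and the class.
  refine (tendsto_add_atTop_iff_nat N).1 ?_
  set ε : ℕ → ℝ := fun n => ε' (n + N) with hεdef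
  have hε : Tendsto ε atTop (𝓝[>] 0) := hε'.comp (tendsto_add_atTop_nat N)
  have hεI : ∀ n, ε n ∈ Set.Ioo (0 : ℝ) 1 := fun n => hN _ (Nat.le_add_left _ _)
  have hPm : ∀ n, Ppath (ε n) ∈ M := fun n => hPpath.1 _ (Set.Ioo_subset_Icc_self (hεI n))
  have hum : ∀ n, upath (ε n) ∈ dominatedClass r Q ustar := fun n =>
    hupath.1 _ (Set.Ioo_subset_Icc_self (hεI n))
  have hPQac := iidLaw_absolutelyContinuous (r := r) (hM P hP Q hQ)
  have hJ : Tendsto (fun n => eLpNorm (fun z => upath (ε n) z - u z) 2 (iidLaw r (P : Measure Z)))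
      atTop (𝓝 0) := by
    have h1 : Tendsto (fun n => eLpNorm (⇑(upath (ε n) - u)) 2 (iidLaw r (Q : Measure Z)))
        atTop (𝓝 0) := by
      have h2 := (tendsto_iff_norm_sub_tendsto_zero.1 (hupath.tendsto.comp hε))
      have h3 := ENNReal.tendsto_ofReal h2
      rw [ENNReal.ofReal_zero] at h3
      refine h3.congr fun n => ?_
      rw [ofReal_norm, Lp.enorm_def]
      rfl
    have h4 := ENNReal.Tendsto.const_mul (a := c' ^ (1 / (2 : ℝ≥0∞)).toReal) h1
      (Or.inr (ENNReal.rpow_ne_top_of_nonneg (by simp) hc'))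
    rw [mul_zero] at h4
    refine ENNReal.tendsto_zero_of_le h4 fun n => ?_
    exact (eLpNorm_congr_ae (hPQac.ae_eq (Lp.coeFn_sub (upath (ε n)) u))).symm.trans_le
      (eLpNorm_le_of_measure_le_smul hPQ)
  have hqmd := hPpath.tendsto_sqrt_rnDeriv_iidLaw hM hP r hε hPm
  have key := tendsto_condExp_differenceQuotient (m := MeasurableSpace.pi.comap (coarsen C r))
    (μ := iidLaw r (P : Measure Z)) (ν := fun n => iidLaw r (Ppath (ε n) : Measure Z))
    hX.comap_le (fun n => iidLaw_absolutelyContinuous (hM _ (hPm n) P hP))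
    (fun n => iidLaw_absolutelyContinuous (hM P hP _ (hPm n)))
    (v := fun n => upath (ε n)) (fun n => (Lp.stronglyMeasurable _).aestronglyMeasurable)
    (Lp.stronglyMeasurable u).aestronglyMeasurable (hbd P hP).1 (fun n => (hbd _ (hPm n)).1)
    (fun n => hPQac (hum n)) (hPQac hu) hK (hbd P hP).2 (fun n => (hbd _ (hPm n)).2)
    (tendsto_nhdsWithin_iff.1 hε).1 (fun n => (hεI n).1.ne')
    ((Lp.memLp (sumCoord r (P : Measure Z) s)).const_mul (1 / 2 : ℝ)) hqmd hJ
  have key2 := ENNReal.Tendsto.const_mul (a := c ^ (1 / (2 : ℝ≥0∞)).toReal) key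
      (Or.inr (ENNReal.rpow_ne_top_of_nonneg (by simp) hc))
  rw [mul_zero] at key2
  have key3 : Tendsto (fun n => ‖(ε n)⁻¹ • (multifoldMeanL2 C r Q (Ppath (ε n)) (upath (ε n)) -
      multifoldMeanL2 C r Q P (upath (ε n)) - ε n • D (sumCoord r (P : Measure Z) s))‖ₑ)
      atTop (𝓝 0) := by
    refine ENNReal.tendsto_zero_of_le key2 fun n => ?_
    set A := multifoldMeanL2 C r Q (Ppath (ε n)) (upath (ε n))
    set B := multifoldMeanL2 C r Q P (upath (ε n))
    set E := D (sumCoord r (P : Measure Z) s)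
    set f : (Fin r → X) → ℝ := fun x => (ε n)⁻¹ * (multifoldMean C r (Ppath (ε n)) (upath (ε n)) x
      - multifoldMean C r P (upath (ε n)) x) - condMean (iidLaw r (P : Measure Z)) (coarsen C r)
        (fun z => sumCoord r (P : Measure Z) s z *
          (u z - multifoldMean C r P u (coarsen C r z))) x with hf
    have hfm : Measurable f := (((measurable_condMean ..).sub (measurable_condMean ..)).const_mul
      _).sub (measurable_condMean ..)
    have hfe : ⇑((ε n)⁻¹ • (A - B - ε n • E)) =ᵐ[iidLaw r ((Q : Measure Z).map C)] f := by
      rw [smul_sub, smul_smul, inv_mul_cancel₀ (hεI n).1.ne', one_smul]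
      filter_upwards [Lp.coeFn_sub ((ε n)⁻¹ • (A - B)) E, Lp.coeFn_smul (ε n)⁻¹ (A - B),
        Lp.coeFn_sub A B, hD (sumCoord r (P : Measure Z) s),
        coeFn_multifoldMeanL2 (memLp_multifoldMean hC hM hK hbd hQ (hPm n) (hum n)),
        coeFn_multifoldMeanL2 (memLp_multifoldMean hC hM hK hbd hQ hP (hum n))]
        with x h1 h2 h3 h4 h5 h6
      rw [h1, Pi.sub_apply, h2, Pi.smul_apply, h3, Pi.sub_apply, h4, h5, h6, smul_eq_mul]
    rw [Lp.enorm_def, eLpNorm_congr_ae hfe]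
    -- Pass from Q_X^r to P_X^r at the cost of a constant, then pull back to P^r, where the limit
    -- was computed.
    refine (eLpNorm_le_of_measure_le_smul hκ).trans (mul_le_mul' le_rfl (le_of_eq ?_))
    rw [← map_coarsen_iidLaw hC, eLpNorm_map_measure hfm.aestronglyMeasurable hX.aemeasurable]
    congr 1
    ext z
    simp only [hf, Function.comp_apply, multifoldMean, condMean_apply]
    -- The half in the derivative of the root density cancels the two in the limit of the ratio
    -- factor.
    congr 3
    ext z
    ring
  have key4 := (ENNReal.tendsto_toReal ENNReal.zero_ne_top).comp key3
  refine key4.congr fun n => ?_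
  rw [Function.comp_apply, toReal_enorm, norm_smul, norm_inv, Real.norm_of_nonneg (hεI n).1.le,
    inv_mul_eq_div]
  rfl

end DominatedClass

/-! ### Adjoints of composition and of operators on a direct sum. -/

section Adjoints

variable {Ω S : Type*} [MeasurableSpace Ω] [mS : MeasurableSpace S] {μ : Measure Ω} {X : Ω → S}
  {ν : Measure S}

/-- The conditional mean is adjoint to composition. -/
theorem integral_comp_mul_eq_integral_mul_condMean [IsFiniteMeasure μ] (hX : Measurable X)
    (hν : μ.map X = ν) {s : S → ℝ} (hs : Measurable s) {F : Ω → ℝ} (hF : Integrable F μ)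
    (hsF : Integrable (fun ω => s (X ω) * F ω) μ) :
    ∫ ω, s (X ω) * F ω ∂μ = ∫ x, s x * condMean μ X F x ∂ν := by
  have hsm : StronglyMeasurable[mS.comap X] fun ω => s (X ω) :=
    hs.stronglyMeasurable.comp_measurable (comap_measurable X)
  rw [← hν, integral_map (f := fun x => s x * condMean μ X F x) hX.aemeasurable
    (hs.mul (measurable_condMean ..)).aestronglyMeasurable, ← integral_condExp hX.comap_le]
  refine integral_congr_ae ((condExp_mul_of_stronglyMeasurable_left hsm hsF hF).trans ?_)
  refine Eventually.of_forall fun ω => ?_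
  simp only [Pi.mul_apply, condMean_apply]

end Adjoints

/-- The adjoint of an operator defined on a direct sum. -/
theorem exists_coprod_adjoint {E F W : Type*} [NormedAddCommGroup E] [InnerProductSpace ℝ E]
    [CompleteSpace E] [NormedAddCommGroup F] [InnerProductSpace ℝ F] [CompleteSpace F]
    [NormedAddCommGroup W] [InnerProductSpace ℝ W] [CompleteSpace W] (A : E →L[ℝ] W)
    (B : F →L[ℝ] W) :
    ∃ D : WithLp 2 (E × F) →L[ℝ] W, (∀ s t, D (WithLp.toLp 2 (s, t)) = A s + B t) ∧
      ∀ w, ContinuousLinearMap.adjoint D w =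
        WithLp.toLp 2 (ContinuousLinearMap.adjoint A w, ContinuousLinearMap.adjoint B w) := by
  have hD : ∀ s t, ((A.coprod B).comp (WithLp.prodContinuousLinearEquiv 2 ℝ E F).toContinuousLinearMap)
      (WithLp.toLp 2 (s, t)) = A s + B t := fun s t => rfl
  refine ⟨_, hD, fun w => ext_inner_left ℝ fun x => ?_⟩
  obtain ⟨s, t⟩ := x
  rw [ContinuousLinearMap.adjoint_inner_right, hD, WithLp.prod_inner_apply, inner_add_left,
    ← ContinuousLinearMap.adjoint_inner_right, ← ContinuousLinearMap.adjoint_inner_right]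

/-! ### Explicit formulas for the differential in the measure and for both adjoints. -/

section Multifold

variable {Z X : Type*} [MeasurableSpace Z] [MeasurableSpace X] {r : ℕ}

theorem memLp_condMean_eval {P : Measure Z} [IsProbabilityMeasure P] {F : (Fin r → Z) → ℝ}
    (hF : MemLp F 2 (iidLaw r P)) (i : Fin r) :
    MemLp (condMean (iidLaw r P) (fun z => z i) F) 2 P :=
  memLp_condMean (measurable_pi_apply i) (measurePreserving_eval (fun _ : Fin r => P) i).map_eq
    (hF.condExp one_le_two)

/-- The adjoint of `s ↦ ∑ᵢ s(zᵢ)` is the sum of the coordinatewise conditional means. -/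
theorem integral_sumCoord_mul {P : Measure Z} [IsProbabilityMeasure P] {F : (Fin r → Z) → ℝ}
    (hF : MemLp F 2 (iidLaw r P)) (s : Lp ℝ 2 P) :
    ∫ z, sumCoord r P s z * F z ∂(iidLaw r P) =
      ∫ z₀, s z₀ * ∑ i, condMean (iidLaw r P) (fun z => z i) F z₀ ∂P := by
  have hsi : ∀ i : Fin r, MemLp (fun z : Fin r → Z => s (z i)) 2 (iidLaw r P) := fun i =>
    (Lp.memLp s).comp_measurePreserving (measurePreserving_eval (fun _ : Fin r => P) i)
  simp_rw [Finset.mul_sum]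
  have hsF : ∀ i : Fin r, Integrable (fun z₀ => s z₀ *
      condMean (iidLaw r P) (fun z => z i) F z₀) P := fun i =>
    (Lp.memLp s).integrable_mul (memLp_condMean_eval hF i)
  have hsF' : ∀ i : Fin r, Integrable (fun z : Fin r → Z => s (z i) * F z) (iidLaw r P) := fun i =>
    (hsi i).integrable_mul hF
  rw [integral_finsetSum _ fun i _ => hsF i]
  have e : ∫ z, sumCoord r P s z * F z ∂(iidLaw r P) =
      ∫ z, ∑ i, s (z i) * F z ∂(iidLaw r P) := by
    refine integral_congr_ae ?_
    filter_upwards [coeFn_sumCoord P s] with z hz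
    rw [hz, Finset.sum_mul]
  rw [e, integral_finsetSum _ fun i _ => hsF' i]
  exact Finset.sum_congr rfl fun i _ => integral_comp_mul_eq_integral_mul_condMean
    (measurable_pi_apply i) (measurePreserving_eval (fun _ : Fin r => P) i).map_eq
    (Lp.stronglyMeasurable s).measurable (hF.integrable one_le_two) (hsF' i)

theorem coeFn_condMean_sumCoord {C : Z → X} (hC : Measurable C) {P : Measure Z}
    [IsProbabilityMeasure P] {f : (Fin r → Z) → ℝ} (hf : MemLp f 2 (iidLaw r P)) (s : Lp ℝ 2 P) :
    condMean (iidLaw r P) (coarsen C r) (fun z => sumCoord r P s z * f z)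
      =ᵐ[iidLaw r (P.map C)] fun x => ∑ i : Fin r, condMean (iidLaw r P) (coarsen C r)
        (fun z => f z * s (z i)) x := by
  have hsi : ∀ i : Fin r, MemLp (fun z : Fin r → Z => s (z i)) 2 (iidLaw r P) := fun i =>
    (Lp.memLp s).comp_measurePreserving (measurePreserving_eval (fun _ : Fin r => P) i)
  refine condMean_ae_eq (measurable_coarsen hC) (map_coarsen_iidLaw hC)
    (Finset.measurable_sum _ fun i _ => measurable_condMean ..) ?_
  simp_rw [condMean_apply]
  have h1 := condExp_finsetSum (s := Finset.univ) (f := fun (i : Fin r) z => f z * s (z i))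
    (fun i _ => hf.integrable_mul (hsi i)) (MeasurableSpace.pi.comap (coarsen C r))
  refine EventuallyEq.trans (condExp_congr_ae ?_) (h1.trans ?_)
  · filter_upwards [coeFn_sumCoord P s] with z hz
    rw [hz, Finset.sum_apply, Finset.sum_mul]
    exact Finset.sum_congr rfl fun i _ => mul_comm _ _
  · exact Eventually.of_forall fun z => Finset.sum_apply z _ _

/-- The adjoint of the derivative of the conditional mean in the measure. -/
theorem coeFn_adjoint_comp_sumCoord {C : Z → X} (hC : Measurable C) {P : Measure Z}
    [IsProbabilityMeasure P] {κ : Measure (Fin r → X)} [IsFiniteMeasure κ] {c : ℝ≥0∞} (hc : c ≠ ∞)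
    (hκ : κ ≤ c • iidLaw r (P.map C)) {f : (Fin r → Z) → ℝ} (hf : MemLp f 2 (iidLaw r P))
    {d : ℝ} (hd : 0 < d) (hfd : ∀ᵐ z ∂(iidLaw r P), ((iidLaw r P)[fun z => f z ^ 2 |
      MeasurableSpace.pi.comap (coarsen C r)]) z ≤ d)
    (hf0 : (iidLaw r P)[f | MeasurableSpace.pi.comap (coarsen C r)] =ᵐ[iidLaw r P] 0)
    {D : Lp ℝ 2 (iidLaw r P) →L[ℝ] Lp ℝ 2 κ}
    (hD : ∀ b, D b =ᵐ[κ] condMean (iidLaw r P) (coarsen C r) fun z => b z * f z)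
    {V : Submodule ℝ (Lp ℝ 2 P)} [CompleteSpace V]
    (hV : (V : Set (Lp ℝ 2 P)) = {s | ∫ z, s z ∂P = 0}) (w : Lp ℝ 2 κ) :
    (ContinuousLinearMap.adjoint ((D.comp (sumCoord r P)).comp V.subtypeL) w : Lp ℝ 2 P)
      =ᵐ[P] fun z₀ => ∑ i : Fin r, condMean (iidLaw r P) (fun z => z i)
        (fun z => (κ.rnDeriv (iidLaw r (P.map C)) (coarsen C r z)).toReal * f z *
          w (coarsen C r z)) z₀ := by
  have hX := measurable_coarsen (r := r) hC
  have hmap := map_coarsen_iidLaw (r := r) (μ := P) hC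
  have hac : κ ≪ iidLaw r (P.map C) := Measure.absolutelyContinuous_of_le_smul hκ
  set F : (Fin r → Z) → ℝ := fun z => (κ.rnDeriv (iidLaw r (P.map C)) (coarsen C r z)).toReal *
    f z * w (coarsen C r z)
  have hFL : MemLp F 2 (iidLaw r P) := memLp_rnDeriv_mul_mul_comp hX hmap hc hκ hf hd hfd w
  have hinner : ∀ b : Lp ℝ 2 (iidLaw r P),
      inner ℝ (D b) w = ∫ z, b z * F z ∂(iidLaw r P) := fun b =>
    inner_condMean_mul hX hmap hc hκ hf hd hfd b w _ (hD b)
  have hGL : MemLp (fun z₀ => ∑ i : Fin r, condMean (iidLaw r P) (fun z => z i) F z₀) 2 P :=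
    memLp_finsetSum _ fun i _ => memLp_condMean_eval hFL i
  -- This integral is the inner product of `D` 1 with w, and `D` 1 is the conditional mean of f,
  -- which vanishes.
  have hF0 : ∫ z, F z ∂(iidLaw r P) = 0 := by
    have h1L : MemLp (fun _ : Fin r → Z => (1 : ℝ)) 2 (iidLaw r P) := memLp_const 1
    have h1 : D (h1L.toLp _) = 0 := by
      refine Lp.ext ((hD _).trans (EventuallyEq.trans (hac.ae_eq ?_)
        (Lp.coeFn_zero ℝ 2 _).symm))
      refine condMean_ae_eq hX hmap measurable_zero ((condExp_congr_ae ?_).trans hf0)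
      filter_upwards [h1L.coeFn_toLp] with z hz
      rw [hz, one_mul]
    have h2 := hinner (h1L.toLp _)
    rw [h1, inner_zero_left] at h2
    rw [h2]
    refine integral_congr_ae ?_
    filter_upwards [h1L.coeFn_toLp] with z hz
    rw [hz, one_mul]
  -- Each of the r conditional means integrates to ∫ F = 0, so the candidate is already tangent and
  -- needs no projection.
  have hGmem : hGL.toLp _ ∈ V := by
    have : hGL.toLp _ ∈ (V : Set (Lp ℝ 2 P)) := by
      rw [hV]
      change ∫ z, (hGL.toLp _ : Lp ℝ 2 P) z ∂P = 0
      rw [integral_congr_ae hGL.coeFn_toLp, integral_finsetSum _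
        fun i _ => (memLp_condMean_eval hFL i).integrable one_le_two]
      refine Finset.sum_eq_zero fun i _ => ?_
      have h1 := integral_comp_mul_eq_integral_mul_condMean (measurable_pi_apply i)
        (measurePreserving_eval (fun _ : Fin r => P) i).map_eq
        (s := fun _ => 1) measurable_const (hFL.integrable one_le_two)
        (by simpa using hFL.integrable one_le_two)
      simp only [one_mul] at h1
      rw [← h1, hF0]
    exact this
  have hadj : ContinuousLinearMap.adjoint ((D.comp (sumCoord r P)).comp V.subtypeL) w =
      ⟨hGL.toLp _, hGmem⟩ := by
    refine ext_inner_left ℝ fun s => ?_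
    rw [ContinuousLinearMap.adjoint_inner_right]
    change inner ℝ (D (sumCoord r P (s : Lp ℝ 2 P))) w = inner ℝ (s : Lp ℝ 2 P) (hGL.toLp _)
    rw [hinner, integral_sumCoord_mul hFL, L2.inner_def]
    refine integral_congr_ae ?_
    filter_upwards [hGL.coeFn_toLp] with z hz
    rw [hz]
    simp [mul_comm]
  rw [hadj]
  exact hGL.coeFn_toLp

end Multifold

/-- The adjoint of the conditional mean with respect to `μ`, as an operator on `L²(ξ)`. -/
theorem coeFn_adjoint_condMean {Ω S : Type*} [MeasurableSpace Ω] [MeasurableSpace S]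
    {μ ξ : Measure Ω} [IsFiniteMeasure μ] [IsFiniteMeasure ξ] {ν κ : Measure S} [IsFiniteMeasure κ]
    {X : Ω → S} (hX : Measurable X) (hν : μ.map X = ν) {c c' : ℝ≥0∞} (hc : c ≠ ∞)
    (hκ : κ ≤ c • ν) (hc' : c' ≠ ∞) (hμξ : μ ≤ c' • ξ)
    {D : Lp ℝ 2 μ →L[ℝ] Lp ℝ 2 κ} (hD : ∀ b, D b =ᵐ[κ] condMean μ X fun ω => b ω * 1)
    {V : Submodule ℝ (Lp ℝ 2 ξ)} [CompleteSpace V] (hV : V = ⊤) (w : Lp ℝ 2 κ) :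
    (ContinuousLinearMap.adjoint ((D.comp (Lp.LpToLpOfMeasureLeSMul hc' hμξ)).comp V.subtypeL) w :
      Lp ℝ 2 ξ) =ᵐ[ξ] fun ω => (μ.rnDeriv ξ ω).toReal * (κ.rnDeriv ν (X ω)).toReal * w (X ω) := by
  have hac : μ ≪ ξ := Measure.absolutelyContinuous_of_le_smul hμξ
  have h1μ : MemLp (fun _ : Ω => (1 : ℝ)) 2 μ := memLp_const 1
  have h1ξ : MemLp (fun _ : Ω => (1 : ℝ)) 2 ξ := memLp_const 1
  have h1dμ : ∀ᵐ ω ∂μ, (μ[fun _ => (1 : ℝ) ^ 2 | MeasurableSpace.comap X inferInstance]) ω ≤ 1 := by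
    rw [condExp_const hX.comap_le]
    simp
  have h1dξ : ∀ᵐ ω ∂ξ, (ξ[fun _ => (1 : ℝ) ^ 2 | MeasurableSpace.comap id inferInstance]) ω ≤ 1 := by
    rw [condExp_const measurable_id.comap_le]
    simp
  set G : Ω → ℝ := fun ω => (κ.rnDeriv ν (X ω)).toReal * 1 * w (X ω) with hG
  have hGL : MemLp G 2 μ := memLp_rnDeriv_mul_mul_comp hX hν hc hκ h1μ one_pos h1dμ w
  have hHL : MemLp (fun ω => (μ.rnDeriv ξ ω).toReal * (κ.rnDeriv ν (X ω)).toReal * w (X ω)) 2 ξ := by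
    have h := memLp_rnDeriv_mul_mul_comp measurable_id (ξ.map_id) hc' hμξ h1ξ one_pos h1dξ
      (hGL.toLp G)
    refine (memLp_congr_ae ?_).1 h
    -- The L² representative of `G` is determined only μ-almost everywhere; where dμ/dξ vanishes, so
    -- does the product.
    have hGe : ∀ᵐ ω ∂ξ, μ.rnDeriv ξ ω ≠ 0 → hGL.toLp G ω = G ω := by
      rw [← ae_withDensity_iff (Measure.measurable_rnDeriv μ ξ),
        Measure.withDensity_rnDeriv_eq μ ξ hac]
      exact hGL.coeFn_toLp
    filter_upwards [hGe] with ω hω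
    by_cases h0 : μ.rnDeriv ξ ω = 0
    · simp [h0]
    · rw [id_eq, hω h0, hG]
      ring
  have hadj : ContinuousLinearMap.adjoint
      ((D.comp (Lp.LpToLpOfMeasureLeSMul hc' hμξ)).comp V.subtypeL) w =
      ⟨hHL.toLp _, by rw [hV]; trivial⟩ := by
    refine ext_inner_left ℝ fun t => ?_
    rw [ContinuousLinearMap.adjoint_inner_right]
    change inner ℝ (D (Lp.LpToLpOfMeasureLeSMul hc' hμξ (t : Lp ℝ 2 ξ))) w =
      inner ℝ (t : Lp ℝ 2 ξ) (hHL.toLp _)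
    rw [inner_condMean_mul hX hν hc hκ h1μ one_pos h1dμ _ w _ (hD _), L2.inner_def]
    calc ∫ ω, Lp.LpToLpOfMeasureLeSMul hc' hμξ (t : Lp ℝ 2 ξ) ω * G ω ∂μ
        = ∫ ω, (t : Lp ℝ 2 ξ) ω * G ω ∂μ := by
          refine integral_congr_ae ?_
          filter_upwards [Lp.coeFn_LpToLpOfMeasureLeSMul hc' hμξ (t : Lp ℝ 2 ξ)] with ω hω
          rw [hω]
      _ = ∫ ω, (μ.rnDeriv ξ ω).toReal • ((t : Lp ℝ 2 ξ) ω * G ω) ∂ξ :=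
          (integral_rnDeriv_smul hac).symm
      _ = _ := by
          refine integral_congr_ae ?_
          filter_upwards [hHL.coeFn_toLp] with ω hω
          rw [hω]
          simp [hG]
          ring
  rw [hadj]
  exact hHL.coeFn_toLp

/-! ### Assembly of the lemma. -/

set_option maxHeartbeats 1000000 in
theorem lemmaS8 {Z X : Type*} [MeasurableSpace Z] [MeasurableSpace X]
    (C : Z → X) (hC : Measurable C) (r : ℕ)
    (M : Set (ProbabilityMeasure Z))
    -- all distributions in the model are equivalent
    (hM : ∀ P₁ ∈ M, ∀ P₂ ∈ M, (P₁ : Measure Z) ≪ (P₂ : Measure Z))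
    -- the dominating function, with conditional second moment bounded uniformly over the model
    (ustar : (Fin r → Z) → ℝ) (hustar : Measurable ustar) (hpos : ∀ z, 0 < ustar z)
    (hbound : ∃ m : ℝ, ∀ P' ∈ M,
      Integrable (fun z => ustar z ^ 2) (iidLaw r (P' : Measure Z)) ∧
      ∀ᵐ x ∂(iidLaw r ((P' : Measure Z).map C)),
        multifoldMean C r P' (fun z => ustar z ^ 2) x ≤ m)
    (Q : ProbabilityMeasure Z) (hQ : Q ∈ M) (P : ProbabilityMeasure Z) (hP : P ∈ M)
    (hnonpar : IsLocallyNonparametricAt M P)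
    (u : Lp ℝ 2 (iidLaw r (Q : Measure Z))) (hu : u ∈ dominatedClass r Q ustar)
    -- the two density ratios are essentially bounded
    (hQP : essSup (((Q : Measure Z).map C).rnDeriv ((P : Measure Z).map C))
      ((P : Measure Z).map C) < ∞)
    (hPQ : essSup ((P : Measure Z).rnDeriv (Q : Measure Z)) (Q : Measure Z) < ∞) :
    -- the map `θ : M × U → L²(Q_X^r)` is well defined
    (∀ P' ∈ M, ∀ u' ∈ dominatedClass r Q ustar,
      Integrable u' (iidLaw r (P' : Measure Z)) ∧
      MemLp (multifoldMean C r P' u') 2 (iidLaw r ((Q : Measure Z).map C))) ∧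
    ∃ (D : TotalTangentSpace M (dominatedClass r Q ustar) P u →L[ℝ]
          Lp ℝ 2 (iidLaw r ((Q : Measure Z).map C)))
      (Dν : modelTangentSpace M P →L[ℝ] Lp ℝ 2 (iidLaw r ((Q : Measure Z).map C)))
      (Dζ : hilbertTangentSpace (dominatedClass r Q ustar) u →L[ℝ]
          Lp ℝ 2 (iidLaw r ((Q : Measure Z).map C))),
      -- total pathwise differentiability, with differential operator `D`
      HasTotalPathwiseDerivAt M (dominatedClass r Q ustar) (multifoldMeanL2 C r Q) P u D ∧
      (∀ s t, D (WithLp.toLp 2 (s, t)) = Dν s + Dζ t) ∧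
      (∀ w, ContinuousLinearMap.adjoint D w =
        WithLp.toLp 2 (ContinuousLinearMap.adjoint Dν w, ContinuousLinearMap.adjoint Dζ w)) ∧
      -- the local parameter
      (∀ s : modelTangentSpace M P,
        (∀ i : Fin r, Integrable
          (fun z => (u z - multifoldMean C r P u (coarsen C r z)) *
            (s : Lp ℝ 2 (P : Measure Z)) (z i)) (iidLaw r (P : Measure Z))) ∧
        Dν s =ᵐ[iidLaw r ((Q : Measure Z).map C)] fun x =>
          ∑ i : Fin r, condMean (iidLaw r (P : Measure Z)) (coarsen C r)
            (fun z => (u z - multifoldMean C r P u (coarsen C r z)) *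
              (s : Lp ℝ 2 (P : Measure Z)) (z i)) x) ∧
      -- its adjoint
      (∀ w : Lp ℝ 2 (iidLaw r ((Q : Measure Z).map C)),
        Integrable
          (fun z => ((iidLaw r ((Q : Measure Z).map C)).rnDeriv
                (iidLaw r ((P : Measure Z).map C)) (coarsen C r z)).toReal *
              (u z - multifoldMean C r P u (coarsen C r z)) * w (coarsen C r z))
          (iidLaw r (P : Measure Z)) ∧
        (ContinuousLinearMap.adjoint Dν w : Lp ℝ 2 (P : Measure Z)) =ᵐ[(P : Measure Z)] fun z₀ =>
          ∑ i : Fin r, condMean (iidLaw r (P : Measure Z)) (fun z => z i)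
            (fun z => ((iidLaw r ((Q : Measure Z).map C)).rnDeriv
                (iidLaw r ((P : Measure Z).map C)) (coarsen C r z)).toReal *
              (u z - multifoldMean C r P u (coarsen C r z)) * w (coarsen C r z)) z₀) ∧
      -- the differential in the second argument
      (∀ t : hilbertTangentSpace (dominatedClass r Q ustar) u,
        Integrable (t : Lp ℝ 2 (iidLaw r (Q : Measure Z))) (iidLaw r (P : Measure Z)) ∧
        Dζ t =ᵐ[iidLaw r ((Q : Measure Z).map C)]
          condMean (iidLaw r (P : Measure Z)) (coarsen C r)
            (t : Lp ℝ 2 (iidLaw r (Q : Measure Z)))) ∧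
      -- its adjoint
      (∀ w : Lp ℝ 2 (iidLaw r ((Q : Measure Z).map C)),
        (ContinuousLinearMap.adjoint Dζ w : Lp ℝ 2 (iidLaw r (Q : Measure Z)))
          =ᵐ[iidLaw r (Q : Measure Z)] fun z =>
            ((iidLaw r (P : Measure Z)).rnDeriv (iidLaw r (Q : Measure Z)) z).toReal *
              ((iidLaw r ((Q : Measure Z).map C)).rnDeriv
                (iidLaw r ((P : Measure Z).map C)) (coarsen C r z)).toReal *
              w (coarsen C r z)) := by
  have hPX : IsProbabilityMeasure ((P : Measure Z).map C) :=
    Measure.isProbabilityMeasure_map hC.aemeasurable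
  have hQX : IsProbabilityMeasure ((Q : Measure Z).map C) :=
    Measure.isProbabilityMeasure_map hC.aemeasurable
  have hX := measurable_coarsen (r := r) hC
  have hmap := map_coarsen_iidLaw (r := r) (μ := (P : Measure Z)) hC
  obtain ⟨m, hm⟩ := hbound
  -- The maximum with 1 makes K positive whatever the bound m.
  let K : ℝ := √(max m 1)
  have hK : 0 < K := Real.sqrt_pos.2 (by positivity)
  have hK2 : K ^ 2 = max m 1 := Real.sq_sqrt (by positivity)
  have hbd : ∀ P' ∈ M, Integrable (fun z => ustar z ^ 2) (iidLaw r (P' : Measure Z)) ∧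
      ∀ᵐ z ∂(iidLaw r (P' : Measure Z)), ((iidLaw r (P' : Measure Z))[fun z => ustar z ^ 2 |
        MeasurableSpace.pi.comap (coarsen C r)]) z ≤ K ^ 2 := by
    intro P' hP'
    refine ⟨(hm P' hP').1, ?_⟩
    have h := (hm P' hP').2
    rw [← map_coarsen_iidLaw hC] at h
    filter_upwards [ae_of_ae_map hX.aemeasurable h] with z hz
    rw [multifoldMean, condMean_apply] at hz
    rw [hK2]
    exact hz.trans (le_max_left _ _)
  have hQPac : iidLaw r ((Q : Measure Z).map C) ≪ iidLaw r ((P : Measure Z).map C) :=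
    iidLaw_absolutelyContinuous ((hM Q hQ P hP).map hC)
  have hPQac : iidLaw r (P : Measure Z) ≪ iidLaw r (Q : Measure Z) :=
    iidLaw_absolutelyContinuous (hM P hP Q hQ)
  have hκ := iidLaw_le_smul (r := r) ((hM Q hQ P hP).map hC)
  have hc := (ENNReal.pow_lt_top hQP (n := r)).ne
  have hJle := iidLaw_le_smul (r := r) (hM P hP Q hQ)
  have hc' := (ENNReal.pow_lt_top hPQ (n := r)).ne
  -- the residual
  let f : (Fin r → Z) → ℝ := fun z => u z - multifoldMean C r P u (coarsen C r z)
  have hfe : f = fun z => u z - ((iidLaw r (P : Measure Z))[u |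
      MeasurableSpace.pi.comap (coarsen C r)]) z := by
    ext z
    simp only [f, multifoldMean, condMean_apply]
  have huL : MemLp u 2 (iidLaw r (P : Measure Z)) :=
    memLp_of_mem_dominatedClass hM (hbd P hP).1 hQ hP hu
  have hfL : MemLp f 2 (iidLaw r (P : Measure Z)) := by
    rw [hfe]
    exact huL.sub (huL.condExp one_le_two)
  have hfd : ∀ᵐ z ∂(iidLaw r (P : Measure Z)), ((iidLaw r (P : Measure Z))[fun z => f z ^ 2 |
      MeasurableSpace.pi.comap (coarsen C r)]) z ≤ 4 * K ^ 2 := by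
    rw [hfe]
    exact condExp_sq_residual_le hX.comap_le huL.1 (hbd P hP).1 (hPQac hu) hK (hbd P hP).2
  have hf0 : (iidLaw r (P : Measure Z))[f | MeasurableSpace.pi.comap (coarsen C r)]
      =ᵐ[iidLaw r (P : Measure Z)] 0 := by
    rw [hfe]
    refine (condExp_sub (huL.integrable one_le_two) integrable_condExp _).trans ?_
    rw [condExp_of_stronglyMeasurable hX.comap_le stronglyMeasurable_condExp
      integrable_condExp, sub_self]
  have h4K : 0 < 4 * K ^ 2 := by positivity
  have h1L : MemLp (fun _ : Fin r → Z => (1 : ℝ)) 2 (iidLaw r (P : Measure Z)) := memLp_const 1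
  have h1d : ∀ᵐ z ∂(iidLaw r (P : Measure Z)),
      ((iidLaw r (P : Measure Z))[fun _ => (1 : ℝ) ^ 2 |
        MeasurableSpace.pi.comap (coarsen C r)]) z ≤ 1 := by
    rw [condExp_const hX.comap_le]
    simp
  -- The same construction gives both differentials: the factor is the residual for the measure, and
  -- the constant 1 for the second argument.
  obtain ⟨Kf, hKf⟩ := exists_condMeanL2 hX hmap hc hκ hfL (d := 4 * K ^ 2) (by positivity) hfd
  obtain ⟨K1, hK1⟩ := exists_condMeanL2 hX hmap hc hκ h1L one_pos h1d
  let J : Lp ℝ 2 (iidLaw r (Q : Measure Z)) →L[ℝ] Lp ℝ 2 (iidLaw r (P : Measure Z)) :=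
    Lp.LpToLpOfMeasureLeSMul hc' hJle
  have hJ : ∀ t, J t =ᵐ[iidLaw r (P : Measure Z)] t := Lp.coeFn_LpToLpOfMeasureLeSMul hc' hJle
  have hK1J : ∀ t : Lp ℝ 2 (iidLaw r (Q : Measure Z)),
      K1 (J t) =ᵐ[iidLaw r ((Q : Measure Z).map C)] multifoldMean C r P t := fun t => by
    refine (hK1 (J t)).trans (hQPac.ae_eq (condMean_congr_ae hX hmap ?_))
    filter_upwards [hJ t] with z hz
    rw [hz, mul_one]
  -- On the class, θ(P, ·) is the bounded linear operator `K1` ∘ `J`, so the remainder in the second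
  -- argument is this operator applied to an o(ε) term.
  have hθJ : ∀ v ∈ dominatedClass r Q ustar, multifoldMeanL2 C r Q P v = K1 (J v) := fun v hv =>
    Lp.ext ((coeFn_multifoldMeanL2 (memLp_multifoldMean hC hM hK hbd hQ hP hv)).trans
      (hK1J v).symm)
  refine ⟨fun P' hP' u' hu' => ⟨(memLp_of_mem_dominatedClass hM (hbd P' hP').1 hQ hP'
    hu').integrable one_le_two, memLp_multifoldMean hC hM hK hbd hQ hP' hu'⟩, ?_⟩
  let Dν : modelTangentSpace M P →L[ℝ] Lp ℝ 2 (iidLaw r ((Q : Measure Z).map C)) :=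
    (Kf.comp (sumCoord r (P : Measure Z))).comp (modelTangentSpace M P).subtypeL
  let Dζ : hilbertTangentSpace (dominatedClass r Q ustar) u →L[ℝ]
      Lp ℝ 2 (iidLaw r ((Q : Measure Z).map C)) :=
    (K1.comp J).comp (hilbertTangentSpace (dominatedClass r Q ustar) u).subtypeL
  obtain ⟨D, hD, hDadj⟩ := exists_coprod_adjoint Dν Dζ
  refine ⟨D, Dν, Dζ, ?_, hD, hDadj, fun s => ⟨fun i => ?_, ?_⟩, fun w => ?_, fun t => ⟨?_, ?_⟩,
    fun w => ?_⟩
  · intro s t Ppath upath hPp hup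
    have h1 := isLittleO_multifoldMeanL2_model hC hM hK hbd hQ hP hc hκ hc' hJle hu hPp hup hKf
    have h2 : (fun ε => K1 (J (upath ε - u - ε • (t : Lp ℝ 2 (iidLaw r (Q : Measure Z))))))
        =o[𝓝[>] 0] fun ε : ℝ => ε :=
      ((K1.comp J).isBigO_comp _ _).trans_isLittleO hup.2
    refine (h1.add h2).congr' ?_ EventuallyEq.rfl
    have hev : ∀ᶠ ε : ℝ in 𝓝[>] 0, ε ∈ Set.Icc (0 : ℝ) 1 :=
      mem_of_superset (Ioo_mem_nhdsGT one_pos) Set.Ioo_subset_Icc_self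
    filter_upwards [hev] with ε hε
    rw [hD, hθJ _ (hup.1 ε hε), hθJ u hu, map_sub, map_sub, map_sub, map_sub, map_smul, map_smul]
    simp only [Dν, Dζ, ContinuousLinearMap.comp_apply, Submodule.subtypeL_apply, smul_add]
    abel
  · exact hfL.integrable_mul ((Lp.memLp (s : Lp ℝ 2 (P : Measure Z))).comp_measurePreserving
      (measurePreserving_eval (fun _ : Fin r => (P : Measure Z)) i))
  · exact (hKf _).trans (hQPac.ae_eq (coeFn_condMean_sumCoord hC hfL _))
  · exact ⟨(memLp_rnDeriv_mul_mul_comp hX hmap hc hκ hfL h4K hfd w).integrable one_le_two,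
      coeFn_adjoint_comp_sumCoord hC hc hκ hfL h4K hfd hf0 hKf hnonpar w⟩
  · exact ((Lp.memLp _).of_measure_le_smul hc' hJle).integrable one_le_two
  · exact hK1J _
  · exact coeFn_adjoint_condMean hX hmap hc hκ hc' hJle hK1
      (hilbertTangentSpace_dominatedClass_eq_top hustar hpos hu) w
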